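/- **Conventions.** The Fourier transform on $\mathcal S(\mathbb R)$ is $\mathcal F[\phi](\xi)=\frac1{\sqrt{2\pi}}\int_{\mathbb R}e^{-ix\xi}\phi(x)\,dx$, extended to $\mathcal S'(\mathbb R)$ by $\langle \mathcal F[T],\phi\rangle=\langle T,\mathcal F[\phi]\rangle$. For $\operatorname{Re} a>-1$, $x_+^a$ (resp. $x_-^a$) is the tempered distribution given by the locally integrable function equal to $|x|^a$ for $x>0$ (resp. $x<0$) and $0$ elsewhere; for other $a\in\mathbb C\setminus\{-1,-2,\dots\}$ one puts $x_\pm^a=\dfrac{(\pm1)^k\,\partial_x^k x_\pm^{a+k}}{(a+1)\cdots(a+k)}$ with $\operatorname{Re}a+k>-1$. The distribution $x_\pm^a/\Gamma(a+1)$ extends to an entire function $\chi_\pm^a$ of $a\in\mathbb C$, $\chi_\pm^a=(\pm1)^k\partial_x^kx_\pm^{a+k}/\Gamma(a+k+1)$ with $\operatorname{Re}a+k>-1$. For $a\in\mathbb C$, $(\xi\pm i0)^a=\lim_{\eta\to0^+}(\xi\pm i\eta)^a$ in $\mathcal S'(\mathbb R)$ (principal branch). A distribution $T$ is positively homogeneous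 of degree $d$ if $\langle T,\phi\rangle=t^d\langle T,t\,\phi(t\,\cdot)\rangle$ for all $t>0$ and $\phi\in\mathcal S(\mathbb R)$. A cut-off function is a nonnegative, compactly supported smooth function on $\mathbb R$ that equals $1$ near $0$. We write $T=O([\xi]^{-\infty})$ if on $\mathbb R\setminus\{0\}$ the distribution $T$ is given by a smooth function $g$ with $g(\xi)=O(|\xi|^{-N})$ as $|\xi|\to\infty$ for every $N$. **Proposition.** Let $\omega$ be a cut-off function and $a\in\mathbb C\setminus\{-1,-2,\dots\}$. In each formula one takes all upper or all lower signs. The limits defining $(\xi\mp i0)^{-a-1}$ and $(x\pm i0)^a$ exist, and: 1. $\mathcal F[x_\pm^a]$ is positively homogeneous of degree $-a-1$ and $$\mathcal F[x_\pm^a]=\frac{\Gamma(a+1)}{\sqrt{2\pi}}\,e^{\mp i\pi(a+1)/2}\,(\xi\mp i0)^{-a-1}.$$ Moreover $\mathcal F[(x\pm i0)^a]=\sqrt{2\pi}\,e^{\pm i\pi a/2}\,\chi_\pm^{-a-1}$, which for $a\notin\{0,1,2,\dots\}$ reads $\mathcal F[(x\pm i0)^a]=\frac{\sqrt{2\pi}}{\Gamma(-a)}\,e^{\pm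 i\pi a/2}\,\xi_\pm^{-a-1}$. 2. $\mathcal F[\omega x_\pm^a]$ is a smooth function on $\mathbb R$, and $\mathcal F[(1-\omega)x_\pm^a]=O([\xi]^{-\infty})$. 3. $\mathcal F[x_\pm^a]=\mathcal F[\omega x_\pm^a]+\mathcal F[(1-\omega)x_\pm^a]$, and $$\mathcal F[\omega x_\pm^a]=\frac{\Gamma(a+1)}{\sqrt{2\pi}}\,e^{\mp i\pi(a+1)/2}\,(\xi\mp i0)^{-a-1}+O([\xi]^{-\infty}).$$ 4. $\dfrac{d}{d\xi}\mathcal F[x_\pm^a]=-i\,\mathcal F[x\cdot x_\pm^a]=\mp i\,\mathcal F[x_\pm^{a+1}]$. -/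

import Mathlib

open scoped SchwartzMap FourierTransform Topology ContDiff
open MeasureTheory Filter

noncomputable section

namespace HomDist

/-! ### Functions as tempered distributions -/

/-- `f` is integrable against `(1 + |x|)^(-N)` for some `N`. -/
def Moderate (f : ℝ → ℂ) : Prop :=
  ∃ N : ℕ, Integrable (fun x : ℝ => ((1 + |x|) ^ N)⁻¹ • f x)

theorem schwartz_bound (N : ℕ) (φ : 𝓢(ℝ, ℂ)) (x : ℝ) :
    ‖φ x‖ ≤ (2 ^ N * (Finset.Iic (N, 0)).sup (schwartzSeminormFamily ℂ ℝ ℂ) φ)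
      * ((1 + |x|) ^ N)⁻¹ := by
  have h := SchwartzMap.one_add_le_sup_seminorm_apply (𝕜 := ℂ) (m := (N, 0)) (k := N) (n := 0)
    le_rfl le_rfl φ x
  rw [norm_iteratedFDeriv_zero, Real.norm_eq_abs] at h
  have hp : (0 : ℝ) < (1 + |x|) ^ N := by positivity
  rw [← div_eq_mul_inv, le_div_iff₀ hp, mul_comm]
  exact h

theorem pairing_norm_le (N : ℕ) (f : ℝ → ℂ) (φ : 𝓢(ℝ, ℂ)) (x : ℝ) :
    ‖f x * φ x‖ ≤ (2 ^ N * (Finset.Iic (N, 0)).sup (schwartzSeminormFamily ℂ ℝ ℂ) φ)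
      * ‖((1 + |x|) ^ N)⁻¹ • f x‖ := by
  have hp : (0 : ℝ) < ((1 + |x|) ^ N)⁻¹ := by positivity
  rw [norm_mul, norm_smul, Real.norm_of_nonneg hp.le]
  calc _ ≤ ‖f x‖ * ((2 ^ N * (Finset.Iic (N, 0)).sup (schwartzSeminormFamily ℂ ℝ ℂ) φ)
      * ((1 + |x|) ^ N)⁻¹) := by gcongr; exact schwartz_bound N φ x
    _ = _ := by ring

theorem Moderate.aestronglyMeasurable {f : ℝ → ℂ} (hf : Moderate f) :
    AEStronglyMeasurable f := by
  obtain ⟨N, hN⟩ := hf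
  have h : AEStronglyMeasurable
      (fun x : ℝ => ((1 + |x|) ^ N) • (((1 + |x|) ^ N)⁻¹ • f x)) :=
    (Continuous.aestronglyMeasurable (f := fun x : ℝ => (1 + |x|) ^ N) (by fun_prop)).smul hN.1
  refine h.congr (Eventually.of_forall fun x => ?_)
  have hp : ((1 + |x|) ^ N : ℝ) ≠ 0 := by positivity
  exact smul_inv_smul₀ hp (f x)

theorem Moderate.integrable_pairing {f : ℝ → ℂ} (hf : Moderate f) (φ : 𝓢(ℝ, ℂ)) :
    Integrable (fun x => f x * φ x) := by
  have hm := hf.aestronglyMeasurable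
  obtain ⟨N, hN⟩ := hf
  exact (hN.norm.const_mul _).mono' (hm.mul φ.continuous.aestronglyMeasurable)
    (Eventually.of_forall (pairing_norm_le N f φ))

open scoped Classical in
/-- The tempered distribution `φ ↦ ∫ f φ` defined by a function `f` as in `Moderate`
(and `0` for other `f`). -/
def ofFun (f : ℝ → ℂ) : 𝓢'(ℝ, ℂ) :=
  if hf : Moderate f then
    ContinuousLinearMap.toPointwiseConvergenceCLM _ _ _ _
      (SchwartzMap.mkCLMtoNormedSpace (𝕜 := ℂ) (σ := RingHom.id ℂ)
        (fun φ : 𝓢(ℝ, ℂ) => ∫ x, f x * φ x)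
        (fun φ ψ => by
          simp only [add_apply, mul_add]
          exact integral_add (hf.integrable_pairing φ) (hf.integrable_pairing ψ))
        (fun c φ => by
          simp only [smul_apply, smul_eq_mul, RingHom.id_apply]
          rw [← integral_const_mul]
          congr 1; ext x; ring)
        (by
          obtain ⟨N, hN⟩ := hf
          refine ⟨Finset.Iic (N, 0), 2 ^ N * ∫ x, ‖((1 + |x|) ^ N)⁻¹ • f x‖, by positivity,
            fun φ => ?_⟩
          refine (norm_integral_le_of_norm_le (hN.norm.const_mul _)
            (Eventually.of_forall (pairing_norm_le N f φ))).trans (le_of_eq ?_)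
          rw [integral_const_mul]; ring))
  else 0

theorem ofFun_apply {f : ℝ → ℂ} (hf : Moderate f) (φ : 𝓢(ℝ, ℂ)) :
    ofFun f φ = ∫ x, f x * φ x := by
  rw [ofFun, dif_pos hf]; rfl

/-! ### Fourier transform with kernel `(2π)^(-1/2) e^{-ixξ}` -/

/-- `φ ↦ φ(t ·)` on Schwartz functions, for `t ≠ 0`. -/
def dilate (t : ℝ) (ht : t ≠ 0) : 𝓢(ℝ, ℂ) →L[ℂ] 𝓢(ℝ, ℂ) :=
  SchwartzMap.compCLMOfContinuousLinearEquiv ℂ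
    (ContinuousLinearEquiv.smulLeft (R₁ := ℝ) (M₁ := ℝ) (Units.mk0 t ht))

theorem dilate_apply (t : ℝ) (ht : t ≠ 0) (φ : 𝓢(ℝ, ℂ)) (x : ℝ) :
    dilate t ht φ x = φ (t * x) := rfl

/-- Fourier transform on Schwartz functions, in the normalisation of `fourierS_apply`. -/
def fourierS : 𝓢(ℝ, ℂ) →L[ℂ] 𝓢(ℝ, ℂ) :=
  ((1 / Real.sqrt (2 * Real.pi) : ℝ) : ℂ) •
    ((dilate (2 * Real.pi)⁻¹ (by positivity)).comp (FourierTransform.fourierCLM ℂ 𝓢(ℝ, ℂ)))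

theorem fourierS_apply (φ : 𝓢(ℝ, ℂ)) (ξ : ℝ) :
    fourierS φ ξ = ((1 / Real.sqrt (2 * Real.pi) : ℝ) : ℂ) *
      ∫ x : ℝ, Complex.exp (-(Complex.I * x * ξ)) * φ x := by
  change _ * (𝓕 φ) ((2 * Real.pi)⁻¹ * ξ) = _
  rw [SchwartzMap.fourier_coe, Real.fourier_real_eq_integral_exp_smul]
  congr 2
  ext x
  rw [smul_eq_mul]
  congr 2
  have : (Real.pi : ℂ) ≠ 0 := by exact_mod_cast Real.pi_ne_zero
  push_cast
  field_simp

/-- Fourier transform on tempered distributions: `⟨F T, φ⟩ = ⟨T, F φ⟩`. -/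
def fourierT : 𝓢'(ℝ, ℂ) →L[ℂ] 𝓢'(ℝ, ℂ) :=
  PointwiseConvergenceCLM.precomp ℂ fourierS

/-! ### The distributions `x_±^a` -/

/-- The sign `±1` as a real number. -/
def sgn (σ : ℤˣ) : ℝ := ((σ : ℤ) : ℝ)

/-- The function `|x|^a` on the half-line `σ x > 0`, and `0` elsewhere. -/
def halfPowFun (σ : ℤˣ) (a : ℂ) (x : ℝ) : ℂ :=
  if 0 < sgn σ * x then ((|x| : ℝ) : ℂ) ^ a else 0

theorem moderate_halfPowFun (σ : ℤˣ) (a : ℂ) (ha : -1 < a.re) : Moderate (halfPowFun σ a) := by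
  have key : Moderate (halfPowFun 1 a) := by
    refine ⟨⌈a.re⌉₊ + 2, ?_⟩
    have hset : (fun x : ℝ => ((1 + |x|) ^ (⌈a.re⌉₊ + 2))⁻¹ • halfPowFun 1 a x)
        = (Set.Ioi 0).indicator
          (fun x : ℝ => ((1 + |x|) ^ (⌈a.re⌉₊ + 2))⁻¹ • ((x : ℂ) ^ a)) := by
      ext x
      by_cases hx : 0 < x
      · simp [halfPowFun, sgn, hx, abs_of_pos hx]
      · simp [halfPowFun, sgn, hx]
    rw [hset, integrable_indicator_iff measurableSet_Ioi, ← Set.Ioc_union_Ioi_eq_Ioi zero_le_one]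
    have hmeas : ∀ s : Set ℝ, AEStronglyMeasurable
        (fun x : ℝ => ((1 + |x|) ^ (⌈a.re⌉₊ + 2))⁻¹ • ((x : ℂ) ^ a)) (volume.restrict s) := by
      intro s
      have : Measurable (fun x : ℝ => ((1 + |x|) ^ (⌈a.re⌉₊ + 2))⁻¹ • ((x : ℂ) ^ a)) := by
        fun_prop
      exact this.aestronglyMeasurable
    refine IntegrableOn.union ?_ ?_
    · have h1 : IntegrableOn (fun x : ℝ => x ^ a.re) (Set.Ioc 0 1) :=
        (intervalIntegrable_iff_integrableOn_Ioc_of_le zero_le_one).1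
          (intervalIntegral.intervalIntegrable_rpow' ha)
      refine Integrable.mono' h1 (hmeas _) ?_
      filter_upwards [ae_restrict_mem measurableSet_Ioc] with x hx
      rw [norm_smul, Complex.norm_cpow_eq_rpow_re_of_pos hx.1, norm_inv, norm_pow,
        Real.norm_of_nonneg (by positivity)]
      have : ((1 + |x|) ^ (⌈a.re⌉₊ + 2))⁻¹ ≤ 1 :=
        inv_le_one_of_one_le₀ (one_le_pow₀ (by linarith [abs_nonneg x]))
      exact mul_le_of_le_one_left (Real.rpow_nonneg hx.1.le _) this
    · have h1 : IntegrableOn (fun x : ℝ => x ^ (-2 : ℝ)) (Set.Ioi 1) :=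
        (integrableOn_Ioi_rpow_iff one_pos).2 (by norm_num)
      refine Integrable.mono' h1 (hmeas _) ?_
      filter_upwards [ae_restrict_mem measurableSet_Ioi] with x hx
      have hx1 : (1 : ℝ) < x := hx
      have hx0 : (0 : ℝ) < x := one_pos.trans hx1
      rw [norm_smul, Complex.norm_cpow_eq_rpow_re_of_pos hx0, norm_inv, norm_pow,
        Real.norm_of_nonneg (by positivity), abs_of_pos hx0]
      have e1 : x ^ a.re ≤ x ^ ⌈a.re⌉₊ := by
        rw [← Real.rpow_natCast]
        exact Real.rpow_le_rpow_of_exponent_le hx1.le (Nat.le_ceil _)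
      have e2 : x ^ (⌈a.re⌉₊ + 2) ≤ (1 + x) ^ (⌈a.re⌉₊ + 2) := by
        gcongr; linarith
      have e3 : x ^ (-2 : ℝ) = (x ^ 2)⁻¹ := by
        rw [Real.rpow_neg hx0.le]; norm_cast
      rw [e3]
      calc _ ≤ (x ^ (⌈a.re⌉₊ + 2))⁻¹ * x ^ ⌈a.re⌉₊ := by gcongr
        _ = _ := by rw [pow_add]; field_simp
  rcases Int.units_eq_one_or σ with rfl | rfl
  · exact key
  · obtain ⟨N, hN⟩ := key
    refine ⟨N, ?_⟩
    convert hN.comp_neg using 2 with x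
    simp [halfPowFun, sgn]

/-- The least `k : ℕ` with `Re a + k > -1` (see `lt_re_add_shift`). -/
def shift (a : ℂ) : ℕ := ⌊-a.re⌋₊

theorem lt_re_add_shift (a : ℂ) : -1 < (a + shift a).re := by
  have := Nat.lt_floor_add_one (-a.re)
  simp only [shift, Complex.add_re, Complex.natCast_re]
  linarith

theorem shift_eq_zero (a : ℂ) (ha : -1 < a.re) : shift a = 0 := by
  rw [shift, Nat.floor_eq_zero]; linarith

/-- The distributional derivative on `ℝ`. -/
def D (T : 𝓢'(ℝ, ℂ)) : 𝓢'(ℝ, ℂ) := TemperedDistribution.derivCLM ℂ T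

/-- The tempered distribution `x_σ^a`, `a ∉ {-1, -2, …}`: the locally integrable function
`halfPowFun σ a` if `Re a > -1`, and otherwise
`σ^k ∂^k x_σ^{a+k} / ((a+1)⋯(a+k))` with `Re a + k > -1`. -/
def halfPow (σ : ℤˣ) (a : ℂ) : 𝓢'(ℝ, ℂ) :=
  (((sgn σ : ℝ) : ℂ) ^ shift a / ∏ j ∈ Finset.range (shift a), (a + (j + 1))) •
    D^[shift a] (ofFun (halfPowFun σ (a + shift a)))

theorem halfPow_of_re (σ : ℤˣ) (a : ℂ) (ha : -1 < a.re) :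
    halfPow σ a = ofFun (halfPowFun σ a) := by
  simp [halfPow, shift_eq_zero a ha]

/-- The entire extension in `a` of `x_σ^a / Γ(a+1)`, namely
`σ^k ∂^k x_σ^{a+k} / Γ(a+k+1)` with `Re a + k > -1`. -/
def normHalfPow (σ : ℤˣ) (a : ℂ) : 𝓢'(ℝ, ℂ) :=
  (((sgn σ : ℝ) : ℂ) ^ shift a / Complex.Gamma (a + shift a + 1)) •
    D^[shift a] (ofFun (halfPowFun σ (a + shift a)))

/-! ### The distributions `(ξ ± i0)^a` -/

/-- The function `ξ ↦ (ξ + σ i η)^a`, with the principal branch of the power. -/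
def lineFun (σ : ℤˣ) (η : ℝ) (a : ℂ) (ξ : ℝ) : ℂ :=
  ((ξ : ℂ) + sgn σ * η * Complex.I) ^ a

theorem abs_sgn (σ : ℤˣ) : |sgn σ| = 1 := by
  rcases Int.units_eq_one_or σ with rfl | rfl <;> simp [sgn]

theorem moderate_lineFun (σ : ℤˣ) (η : ℝ) (hη : 0 < η) (a : ℂ) : Moderate (lineFun σ η a) := by
  have him : ∀ ξ : ℝ, ((ξ : ℂ) + sgn σ * η * Complex.I).im = sgn σ * η := by
    intro ξ; simp
  have hs : sgn σ ≠ 0 := by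
    intro h; have := abs_sgn σ; rw [h] at this; simp at this
  have him0 : ∀ ξ : ℝ, ((ξ : ℂ) + sgn σ * η * Complex.I).im ≠ 0 := by
    intro ξ; rw [him]; exact mul_ne_zero hs hη.ne'
  have hcont : Continuous (lineFun σ η a) := by
    unfold lineFun
    refine Continuous.cpow (by fun_prop) continuous_const fun ξ => ?_
    exact Or.inr (him0 ξ)
  have hlow : ∀ ξ : ℝ, η ≤ ‖(ξ : ℂ) + sgn σ * η * Complex.I‖ := by
    intro ξ
    have := Complex.abs_im_le_norm ((ξ : ℂ) + sgn σ * η * Complex.I)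
    rwa [him, abs_mul, abs_sgn, one_mul, abs_of_pos hη] at this
  have hup : ∀ ξ : ℝ, ‖(ξ : ℂ) + sgn σ * η * Complex.I‖ ≤ (1 + η) * (1 + |ξ|) := by
    intro ξ
    refine (norm_add_le _ _).trans ?_
    rw [Complex.norm_mul, Complex.norm_mul, Complex.norm_I, Complex.norm_real, Complex.norm_real,
      Complex.norm_real, Real.norm_eq_abs, Real.norm_eq_abs, Real.norm_eq_abs, abs_sgn,
      abs_of_pos hη]
    nlinarith [abs_nonneg ξ]
  set m : ℕ := ⌈a.re⌉₊ with hm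
  set C : ℝ := (η ^ a.re + (1 + η) ^ m + 1) * Real.exp (Real.pi * |a.im|) with hC
  have hC0 : 0 ≤ C := by positivity
  have hbound : ∀ ξ : ℝ, ‖lineFun σ η a ξ‖ ≤ C * (1 + |ξ|) ^ m := by
    intro ξ
    set z : ℂ := (ξ : ℂ) + sgn σ * η * Complex.I with hz
    have hz0 : z ≠ 0 := by
      intro h; have := him0 ξ; rw [← hz, h] at this; simp at this
    have hnz : 0 < ‖z‖ := norm_pos_iff.2 hz0
    have h1 : (1 : ℝ) ≤ (1 + |ξ|) ^ m := one_le_pow₀ (by linarith [abs_nonneg ξ])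
    have hpow : ‖z‖ ^ a.re ≤ (η ^ a.re + (1 + η) ^ m + 1) * (1 + |ξ|) ^ m := by
      have hη' : 0 ≤ η ^ a.re := by positivity
      have hη'' : 0 ≤ (1 + η) ^ m := by positivity
      rcases le_or_gt a.re 0 with hr | hr
      · have := Real.rpow_le_rpow_of_nonpos hη (hlow ξ) hr
        nlinarith
      · have h2 : ‖z‖ ^ a.re ≤ ((1 + η) * (1 + |ξ|)) ^ a.re :=
          Real.rpow_le_rpow hnz.le (hup ξ) hr.le
        have h3 : ((1 + η) * (1 + |ξ|)) ^ a.re ≤ ((1 + η) * (1 + |ξ|)) ^ m := by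
          rw [← Real.rpow_natCast]
          exact Real.rpow_le_rpow_of_exponent_le (by nlinarith [abs_nonneg ξ]) (Nat.le_ceil _)
        rw [mul_pow] at h3
        nlinarith
    have hexp : (Real.exp (Complex.arg z * a.im))⁻¹ ≤ Real.exp (Real.pi * |a.im|) := by
      rw [← Real.exp_neg]
      gcongr
      calc _ ≤ |Complex.arg z * a.im| := neg_le_abs _
        _ = |Complex.arg z| * |a.im| := abs_mul _ _
        _ ≤ _ := by gcongr; exact Complex.abs_arg_le_pi z
    rw [lineFun, ← hz, Complex.norm_cpow_of_ne_zero hz0, div_eq_mul_inv]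
    calc _ ≤ ((η ^ a.re + (1 + η) ^ m + 1) * (1 + |ξ|) ^ m) * Real.exp (Real.pi * |a.im|) := by
          gcongr
      _ = _ := by rw [hC]; ring
  refine ⟨m + 2, ?_⟩
  have hint : Integrable (fun x : ℝ => C * (1 + ‖x‖) ^ (-(2 : ℝ))) :=
    (integrable_one_add_norm (by simp)).const_mul C
  refine hint.mono' ?_ (Eventually.of_forall fun x => ?_)
  · refine Continuous.aestronglyMeasurable
      (Continuous.smul (f := fun x : ℝ => ((1 + |x|) ^ (m + 2))⁻¹) ?_ hcont)
    refine Continuous.inv₀ (by fun_prop) fun x => ?_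
    positivity
  · have hp : (0 : ℝ) < 1 + |x| := by positivity
    rw [norm_smul, norm_inv, norm_pow, Real.norm_of_nonneg hp.le, Real.rpow_neg (by positivity),
      Real.norm_eq_abs]
    have e : (1 + |x|) ^ (2 : ℝ) = (1 + |x|) ^ 2 := by norm_cast
    rw [e]
    calc _ ≤ ((1 + |x|) ^ (m + 2))⁻¹ * (C * (1 + |x|) ^ m) := by gcongr; exact hbound x
      _ = _ := by rw [pow_add]; field_simp

/-- The tempered distribution `(ξ + σ i0)^a`, i.e. the limit of `(ξ + σ i η)^a` in `𝓢'` (with the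
topology of pointwise convergence on Schwartz functions) as `η → 0+`. -/
def boundaryPow (σ : ℤˣ) (a : ℂ) : 𝓢'(ℝ, ℂ) :=
  limUnder (𝓝[>] (0 : ℝ)) (fun η => ofFun (lineFun σ η a))

/-! ### Remaining notions -/

/-- `T` is positively homogeneous of degree `d`: `⟨T, φ⟩ = t^d ⟨T, t φ(t ·)⟩` for all `t > 0`. -/
def IsPosHomogeneous (T : 𝓢'(ℝ, ℂ)) (d : ℂ) : Prop :=
  ∀ (t : ℝ) (ht : 0 < t) (φ : 𝓢(ℝ, ℂ)), T φ = (t : ℂ) ^ d * T ((t : ℂ) • dilate t ht.ne' φ)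

/-- A cut-off function around zero; `w` may but need not be monotone in `|x|`. -/
structure IsCutoff (w : ℝ → ℝ) : Prop where
  smooth : ContDiff ℝ ∞ w
  compact : HasCompactSupport w
  nonneg : ∀ x, 0 ≤ w x
  eq_one : ∀ᶠ x in 𝓝 (0 : ℝ), w x = 1

/-- The product `g T` of a tempered distribution with a (real, smooth, temperate) function. -/
def mulFun (g : ℝ → ℝ) (T : 𝓢'(ℝ, ℂ)) : 𝓢'(ℝ, ℂ) :=
  TemperedDistribution.smulLeftCLM ℂ (fun x => (g x : ℂ)) T

/-- `T` is given by a smooth function on all of `ℝ`. -/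
def IsSmoothFun (T : 𝓢'(ℝ, ℂ)) : Prop :=
  ∃ g : ℝ → ℂ, ContDiff ℝ ∞ g ∧ Moderate g ∧ T = ofFun g

/-- On `ℝ \ {0}`, `T` is given by a smooth function `g` with `g ξ = O(|ξ|^{-N})` as `|ξ| → ∞`, for
every `N`. -/
def IsRapidlyDecreasing (T : 𝓢'(ℝ, ℂ)) : Prop :=
  ∃ g : ℝ → ℂ, ContDiffOn ℝ ∞ g {0}ᶜ ∧
    (∀ N : ℕ, g =O[cocompact ℝ] (fun ξ : ℝ => (|ξ| ^ N)⁻¹)) ∧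
    ∀ φ : 𝓢(ℝ, ℂ), (0 : ℝ) ∉ tsupport φ → T φ = ∫ ξ, g ξ * φ ξ

end HomDist

end

noncomputable section

namespace HomDist

/-! ### Operations on tempered distributions -/

/-! The argument is run for the normalised family χ_σ^b, where division by Γ(b+1) removes all
exceptional exponents: ∂χ_σ^{b+1} = σ χ_σ^b (`D_normHalfPow`) and xχ_σ^b = σ(b+1)χ_σ^{b+1}
(`mulX_normHalfPow`) hold for every b. An identity for χ_σ^b is checked on locally integrable
functions for Re b > -1 and then carried from b+1 to b by `re_descent`. Since x_σ^a = Γ(a+1)χ_σ^a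
for admissible a (`halfPow_eq_smul`), the results transfer back.

Fourier transform: for Re b > -1, damping by e^{-η|x|} turns it into the Laplace integral of x^b at
η + iσξ, which is Γ(b+1)(η + iσξ)^{-b-1} (`integral_cpow_mul_cexp`). Factoring out σi rewrites this
as a phase times (ξ - iση)^{-b-1} (`add_mul_I_cpow`), and η → 0+ is dominated convergence. In the
descent, raising the exponent of the boundary value by one is multiplication by ξ - iση, and its
η-part disappears in the limit. So `tendsto_lineFun` gives the existence of all boundary values
together with their formula. The transform of (x + σi0)^a follows because the Fourier transform
squared is reflection, and homogeneity follows from scaling (ξ + iση)^a.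

Cut-offs: with compactly supported u, the rule u·∂T = ∂(uT) - u'T reduces F[u x_σ^a] to transforms
of compactly supported integrable functions, which are smooth. For u vanishing near 0 and locally
constant near infinity, ξF[uχ^b] is a combination of F[u'χ^b] and F[uχ^{b-1}]. The first has
compactly supported u', the second better decay in x, so iterating yields any number of derivatives
and any power of decay off ξ = 0 (`isPowerDecreasing_fourierT_mulFun`). Splitting 1 = ω + (1-ω) then
gives the statement for ωx_σ^a. -/

theorem D_apply (T : 𝓢'(ℝ, ℂ)) (φ : 𝓢(ℝ, ℂ)) : D T φ = -T (SchwartzMap.derivCLM ℂ ℂ φ) := by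
  change T (-SchwartzMap.derivCLM ℂ ℂ φ) = _
  rw [map_neg]

theorem D_smul (c : ℂ) (T : 𝓢'(ℝ, ℂ)) : D (c • T) = c • D T := map_smul _ _ _

theorem mulFun_apply (g : ℝ → ℝ) (T : 𝓢'(ℝ, ℂ)) (φ : 𝓢(ℝ, ℂ)) :
    mulFun g T φ = T (SchwartzMap.smulLeftCLM ℂ (fun x => (g x : ℂ)) φ) := rfl

theorem mulFun_smul (g : ℝ → ℝ) (c : ℂ) (T : 𝓢'(ℝ, ℂ)) :
    mulFun g (c • T) = c • mulFun g T := map_smul _ _ _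

theorem hasTemperateGrowth_ofReal {g : ℝ → ℝ} (hg : g.HasTemperateGrowth) :
    (fun x => (g x : ℂ)).HasTemperateGrowth :=
  Function.Complex.hasTemperateGrowth_ofReal.comp hg

theorem fourierT_apply (T : 𝓢'(ℝ, ℂ)) (φ : 𝓢(ℝ, ℂ)) : fourierT T φ = T (fourierS φ) := rfl

theorem smulLeft_apply {g : ℝ → ℝ} (hg : g.HasTemperateGrowth) (φ : 𝓢(ℝ, ℂ)) (x : ℝ) :
    SchwartzMap.smulLeftCLM ℂ (fun x => (g x : ℂ)) φ x = g x * φ x := by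
  rw [SchwartzMap.smulLeftCLM_apply_apply (hasTemperateGrowth_ofReal hg), smul_eq_mul]

theorem D_mulFun {g : ℝ → ℝ} (hg : g.HasTemperateGrowth) (hg' : (deriv g).HasTemperateGrowth)
    (T : 𝓢'(ℝ, ℂ)) : D (mulFun g T) = mulFun (deriv g) T + mulFun g (D T) := by
  ext φ
  have key : SchwartzMap.derivCLM ℂ ℂ (SchwartzMap.smulLeftCLM ℂ (fun x => (g x : ℂ)) φ) =
      SchwartzMap.smulLeftCLM ℂ (fun x => ((deriv g x : ℝ) : ℂ)) φ +
      SchwartzMap.smulLeftCLM ℂ (fun x => (g x : ℂ)) (SchwartzMap.derivCLM ℂ ℂ φ) := by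
    ext x
    have h1 : HasDerivAt g (deriv g x) x := (hg.1.differentiable (by simp) x).hasDerivAt
    have h2 := h1.ofReal_comp.mul (φ.hasDerivAt x)
    rw [add_apply, SchwartzMap.derivCLM_apply, smulLeft_apply hg, smulLeft_apply hg',
      SchwartzMap.derivCLM_apply, ← h2.deriv]
    congr 1
    ext y
    simp [smulLeft_apply hg]
  rw [add_apply, D_apply, mulFun_apply, mulFun_apply, mulFun_apply, D_apply, key, map_add]
  ring

theorem mulFun_add_mulFun_one_sub {g : ℝ → ℝ} (hg : g.HasTemperateGrowth) (T : 𝓢'(ℝ, ℂ)) :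
    mulFun g T + mulFun (fun x => 1 - g x) T = T := by
  have hg' : (fun x => 1 - g x).HasTemperateGrowth :=
    (Function.HasTemperateGrowth.const 1).sub hg
  ext φ
  rw [add_apply, mulFun_apply, mulFun_apply, ← map_add]
  congr 1
  ext x
  rw [add_apply, smulLeft_apply hg, smulLeft_apply hg']
  push_cast
  ring

/-- Multiplication of a tempered distribution by the coordinate function. -/
def mulX (T : 𝓢'(ℝ, ℂ)) : 𝓢'(ℝ, ℂ) := mulFun (fun x => x) T

/-- Multiplication of a Schwartz function by the coordinate function. -/
def mulXS (φ : 𝓢(ℝ, ℂ)) : 𝓢(ℝ, ℂ) := SchwartzMap.smulLeftCLM ℂ (fun x : ℝ => (x : ℂ)) φ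

theorem mulX_apply (T : 𝓢'(ℝ, ℂ)) (φ : 𝓢(ℝ, ℂ)) : mulX T φ = T (mulXS φ) := rfl

theorem mulXS_apply (φ : 𝓢(ℝ, ℂ)) (x : ℝ) : mulXS φ x = x * φ x :=
  smulLeft_apply Function.HasTemperateGrowth.id' φ x

theorem mulX_smul (c : ℂ) (T : 𝓢'(ℝ, ℂ)) : mulX (c • T) = c • mulX T := mulFun_smul _ _ _

theorem mulX_D (T : 𝓢'(ℝ, ℂ)) : mulX (D T) = D (mulX T) - T := by
  have h : deriv (fun x : ℝ => x) = fun _ => 1 := by ext; simp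
  rw [mulX, mulX, D_mulFun Function.HasTemperateGrowth.id' (by rw [h]; fun_prop), h]
  ext φ
  have : SchwartzMap.smulLeftCLM ℂ (fun _ : ℝ => ((1 : ℝ) : ℂ)) φ = φ := by
    ext x
    simp
  rw [sub_apply, add_apply, mulFun_apply (fun _ => 1), this]
  ring

/-! ### Fourier transform against derivative, coordinate and reflection -/

theorem fourierS_apply_eq (φ : 𝓢(ℝ, ℂ)) (ξ : ℝ) :
    fourierS φ ξ = ((1 / Real.sqrt (2 * Real.pi) : ℝ) : ℂ) * (𝓕 φ) ((2 * Real.pi)⁻¹ * ξ) := rfl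

theorem fourierS_derivCLM (φ : 𝓢(ℝ, ℂ)) :
    fourierS (SchwartzMap.derivCLM ℂ ℂ φ) = Complex.I • mulXS (fourierS φ) := by
  ext ξ
  rw [smul_apply, mulXS_apply, fourierS_apply_eq, fourierS_apply_eq, SchwartzMap.fourier_coe,
    SchwartzMap.fourier_coe]
  have h : ((SchwartzMap.derivCLM ℂ ℂ φ : 𝓢(ℝ, ℂ)) : ℝ → ℂ) = deriv φ := by ext; simp
  rw [h, Real.fourier_deriv φ.integrable φ.differentiable
    (h ▸ (SchwartzMap.derivCLM ℂ ℂ φ).integrable)]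
  have : (Real.pi : ℂ) ≠ 0 := by exact_mod_cast Real.pi_ne_zero
  simp only [smul_eq_mul]
  push_cast
  field_simp

theorem derivCLM_fourierS (φ : 𝓢(ℝ, ℂ)) :
    SchwartzMap.derivCLM ℂ ℂ (fourierS φ) = (-Complex.I) • fourierS (mulXS φ) := by
  ext ξ
  rw [smul_apply, SchwartzMap.derivCLM_apply, fourierS_apply_eq, SchwartzMap.fourier_coe]
  have hx : Integrable (fun x : ℝ => x • φ x) := by
    refine (mulXS φ).integrable.congr (Eventually.of_forall fun x => ?_)
    rw [mulXS_apply]; simp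
  have h1 := Real.hasDerivAt_fourier φ.integrable hx ((2 * Real.pi)⁻¹ * ξ)
  have h2 : HasDerivAt (fun ξ : ℝ => (2 * Real.pi)⁻¹ * ξ) (2 * Real.pi)⁻¹ ξ := by
    simpa using (hasDerivAt_id ξ).const_mul (2 * Real.pi)⁻¹
  have h3 := (h1.scomp ξ h2).const_mul ((1 / Real.sqrt (2 * Real.pi) : ℝ) : ℂ)
  refine (h3.deriv).trans ?_
  have h4 : 𝓕 (fun x : ℝ => (-2 * Real.pi * Complex.I * x) • φ x) =
      fun w => (-2 * Real.pi * Complex.I) * 𝓕 (fun x => mulXS φ x) w := by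
    ext w
    rw [Real.fourier_eq, Real.fourier_eq, ← integral_const_mul]
    congr 1
    ext x
    rw [mulXS_apply, Circle.smul_def, Circle.smul_def]
    simp only [smul_eq_mul]
    ring
  rw [h4]
  have : (Real.pi : ℂ) ≠ 0 := by exact_mod_cast Real.pi_ne_zero
  simp only [Complex.real_smul, smul_eq_mul]
  push_cast
  field_simp

theorem fourierS_fourierS (φ : 𝓢(ℝ, ℂ)) : fourierS (fourierS φ) = dilate (-1) (by norm_num) φ := by
  ext x
  rw [dilate_apply, fourierS_apply]
  have hpi : (0 : ℝ) < 2 * Real.pi := by positivity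
  obtain ⟨G, hG⟩ : ∃ G : ℝ → ℂ, G = fun s => ((1 / Real.sqrt (2 * Real.pi) : ℝ) : ℂ) *
        (Complex.exp (↑(-2 * Real.pi * s * x) * Complex.I) • (𝓕 φ) s) := ⟨_, rfl⟩
  have h1 : ∀ y : ℝ, Complex.exp (-(Complex.I * y * x)) * fourierS φ y =
      G ((2 * Real.pi)⁻¹ * y) := by
    intro y
    have : (Real.pi : ℂ) ≠ 0 := by exact_mod_cast Real.pi_ne_zero
    have h2 : -(Complex.I * y * x) =
        ((-2 * Real.pi * ((2 * Real.pi)⁻¹ * y) * x : ℝ) : ℂ) * Complex.I := by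
      push_cast; field_simp
    rw [hG, fourierS_apply_eq, h2]
    simp only [smul_eq_mul]
    ring
  -- The substitution y = 2πs contributes a factor 2π, which cancels the two prefactors (2π)^{-1/2}.
  rw [integral_congr_ae (Eventually.of_forall h1), Measure.integral_comp_mul_left, hG,
    integral_const_mul,
    ← Real.fourier_real_eq_integral_exp_smul, inv_inv, abs_of_pos hpi]
  have h3 : 𝓕 (((𝓕 φ : 𝓢(ℝ, ℂ))) : ℝ → ℂ) x = φ (-1 * x) := by
    have h0 : 𝓕⁻ (𝓕 φ : 𝓢(ℝ, ℂ)) = φ := FourierTransform.fourierInv_fourier_eq φ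
    have h := congrArg (fun ψ : 𝓢(ℝ, ℂ) => ψ (-x)) h0
    simp only [SchwartzMap.fourierInv_coe, Real.fourierInv_eq_fourier_neg, neg_neg] at h
    rw [neg_one_mul, ← h]
  rw [h3]
  have h4 : Real.sqrt (2 * Real.pi) * Real.sqrt (2 * Real.pi) = 2 * Real.pi :=
    Real.mul_self_sqrt hpi.le
  have h5 : Real.sqrt (2 * Real.pi) ≠ 0 := by positivity
  rw [Complex.real_smul, ← mul_assoc, ← mul_assoc, ← Complex.ofReal_mul, ← Complex.ofReal_mul]
  have h6 : 1 / Real.sqrt (2 * Real.pi) * (2 * Real.pi) * (1 / Real.sqrt (2 * Real.pi)) = 1 := by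
    field_simp
    nlinarith
  rw [h6]; simp

theorem fourierT_D (T : 𝓢'(ℝ, ℂ)) : fourierT (D T) = Complex.I • mulX (fourierT T) := by
  ext φ
  rw [fourierT_apply, D_apply, derivCLM_fourierS, smul_apply, mulX_apply, fourierT_apply,
    map_smul, smul_eq_mul, smul_eq_mul]
  ring

theorem D_fourierT (T : 𝓢'(ℝ, ℂ)) : D (fourierT T) = (-Complex.I) • fourierT (mulX T) := by
  ext φ
  rw [D_apply, fourierT_apply, fourierS_derivCLM, smul_apply, fourierT_apply, mulX_apply,
    map_smul, smul_eq_mul, smul_eq_mul]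
  ring

theorem fourierT_fourierT_apply (T : 𝓢'(ℝ, ℂ)) (φ : 𝓢(ℝ, ℂ)) :
    fourierT (fourierT T) φ = T (dilate (-1) (by norm_num) φ) := by
  rw [fourierT_apply, fourierT_apply, fourierS_fourierS]

theorem derivCLM_dilate_neg_one (φ : 𝓢(ℝ, ℂ)) :
    SchwartzMap.derivCLM ℂ ℂ (dilate (-1) (by norm_num) φ) =
      -dilate (-1) (by norm_num) (SchwartzMap.derivCLM ℂ ℂ φ) := by
  ext x
  rw [neg_apply, dilate_apply, SchwartzMap.derivCLM_apply, SchwartzMap.derivCLM_apply]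
  have h : (⇑(dilate (-1) (by norm_num) φ) : ℝ → ℂ) = fun x => φ (-x) := by
    ext y; rw [dilate_apply, neg_one_mul]
  rw [h, deriv_comp_neg, neg_one_mul]

/-! ### Signs -/

theorem sgn_mul_self (σ : ℤˣ) : sgn σ * sgn σ = 1 := by
  rcases Int.units_eq_one_or σ with rfl | rfl <;> simp [sgn]

theorem sgn_mul_self_complex (σ : ℤˣ) : (sgn σ : ℂ) * sgn σ = 1 := by
  rw [← Complex.ofReal_mul, sgn_mul_self, Complex.ofReal_one]

theorem sgn_ne_zero (σ : ℤˣ) : sgn σ ≠ 0 := left_ne_zero_of_mul_eq_one (sgn_mul_self σ)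

theorem sgn_neg (σ : ℤˣ) : sgn (-σ) = -sgn σ := by simp [sgn]

/-! ### Functions on the half-line -/

theorem halfPowFun_sgn_mul (σ : ℤˣ) (b : ℂ) (x : ℝ) :
    halfPowFun σ b (sgn σ * x) = (Set.Ioi 0).indicator (fun x : ℝ => (x : ℂ) ^ b) x := by
  rw [halfPowFun, ← mul_assoc, sgn_mul_self, one_mul, abs_mul, abs_sgn, one_mul]
  by_cases hx : 0 < x
  · simp [hx, abs_of_pos hx]
  · simp [hx]

theorem halfPowFun_sgn_mul_mul (σ : ℤˣ) (b : ℂ) (f : ℝ → ℂ) (x : ℝ) :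
    halfPowFun σ b (sgn σ * x) * f (sgn σ * x) =
      (Set.Ioi 0).indicator (fun x : ℝ => (x : ℂ) ^ b * f (sgn σ * x)) x := by
  rw [halfPowFun_sgn_mul]
  by_cases hx : x ∈ Set.Ioi (0 : ℝ) <;> simp [hx]

theorem integral_comp_sgn_mul (σ : ℤˣ) (g : ℝ → ℂ) : ∫ x, g (sgn σ * x) = ∫ x, g x := by
  rw [Measure.integral_comp_mul_left, abs_inv, abs_sgn, inv_one, one_smul]

theorem integrable_comp_sgn_mul (σ : ℤˣ) (g : ℝ → ℂ) :
    Integrable (fun x => g (sgn σ * x)) ↔ Integrable g :=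
  integrable_comp_mul_left_iff g (sgn_ne_zero σ)

theorem integral_halfPowFun_mul (σ : ℤˣ) (b : ℂ) (f : ℝ → ℂ) :
    ∫ x, halfPowFun σ b x * f x = ∫ x in Set.Ioi (0 : ℝ), (x : ℂ) ^ b * f (sgn σ * x) := by
  rw [← integral_comp_sgn_mul σ (fun x => halfPowFun σ b x * f x)]
  simp_rw [halfPowFun_sgn_mul_mul]
  rw [integral_indicator measurableSet_Ioi]

theorem integrable_halfPowFun_mul_iff (σ : ℤˣ) (b : ℂ) (f : ℝ → ℂ) :
    Integrable (fun x => halfPowFun σ b x * f x) ↔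
      IntegrableOn (fun x : ℝ => (x : ℂ) ^ b * f (sgn σ * x)) (Set.Ioi 0) := by
  rw [← integrable_comp_sgn_mul σ (fun x => halfPowFun σ b x * f x)]
  simp_rw [halfPowFun_sgn_mul_mul]
  rw [integrable_indicator_iff measurableSet_Ioi]

theorem measurable_halfPowFun (σ : ℤˣ) (b : ℂ) : Measurable (halfPowFun σ b) := by
  unfold halfPowFun
  refine Measurable.ite (measurableSet_lt measurable_const (by fun_prop)) ?_ measurable_const
  fun_prop

theorem norm_halfPowFun (σ : ℤˣ) (b : ℂ) (x : ℝ) :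
    ‖halfPowFun σ b x‖ = if 0 < sgn σ * x then |x| ^ b.re else 0 := by
  rw [halfPowFun]
  split_ifs with h
  · exact Complex.norm_cpow_eq_rpow_re_of_pos (abs_pos.2 fun hx => by simp [hx] at h) _
  · simp

theorem Moderate.mono {f g : ℝ → ℂ} (hf : Moderate f) (hg : AEStronglyMeasurable g) (C : ℝ)
    (h : ∀ x, ‖g x‖ ≤ C * ‖f x‖) : Moderate g := by
  obtain ⟨N, hN⟩ := hf
  refine ⟨N, (hN.norm.const_mul C).mono' ?_ (Eventually.of_forall fun x => ?_)⟩
  · refine AEStronglyMeasurable.smul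
      (Continuous.aestronglyMeasurable (f := fun x : ℝ => ((1 + |x|) ^ N)⁻¹) ?_) hg
    refine Continuous.inv₀ (by fun_prop) fun x => ?_
    positivity
  · rw [norm_smul, norm_smul]
    calc _ ≤ ‖((1 + |x|) ^ N)⁻¹‖ * (C * ‖f x‖) := by gcongr; exact h x
      _ = _ := by ring

/-- For |x| ≥ ε one has |x|^{Re b} ≤ ε^{-k}|x|^{Re b + k}, and k = `shift b` makes the exponent on
the right exceed -1. -/
theorem moderate_halfPowFun_away (σ : ℤˣ) (b : ℂ) {ε : ℝ} (hε : 0 < ε) :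
    Moderate (fun x => if ε ≤ |x| then halfPowFun σ b x else 0) := by
  refine (moderate_halfPowFun σ _ (lt_re_add_shift b)).mono ?_ ((ε ^ shift b)⁻¹) fun x => ?_
  · exact (Measurable.ite (measurableSet_le measurable_const measurable_norm)
      (measurable_halfPowFun σ b) measurable_const).aestronglyMeasurable
  · split_ifs with hx
    · have hx0 : 0 < |x| := hε.trans_le hx
      rw [norm_halfPowFun, norm_halfPowFun]
      split_ifs with h
      · rw [Complex.add_re, Complex.natCast_re, Real.rpow_add_natCast hx0.ne',
          ← div_eq_inv_mul, le_div_iff₀ (by positivity)]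
        gcongr
      · simp
    · simp only [norm_zero]
      positivity

theorem integrable_halfPowFun_mul_of_eventuallyEq_zero (σ : ℤˣ) (b : ℂ) (ψ : 𝓢(ℝ, ℂ))
    (hψ : ψ =ᶠ[𝓝 0] 0) : Integrable (fun x => halfPowFun σ b x * ψ x) := by
  obtain ⟨ε, hε, h⟩ := Metric.eventually_nhds_iff.1 hψ
  refine ((moderate_halfPowFun_away σ b hε).integrable_pairing ψ).congr
    (Eventually.of_forall fun x => ?_)
  dsimp only
  split_ifs with hx
  · rfl
  · rw [h (by simpa using hx)]; simp

theorem hasDerivAt_cpow_add_one (b : ℂ) {x : ℝ} (hx : 0 < x) :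
    HasDerivAt (fun x : ℝ => (x : ℂ) ^ (b + 1)) ((b + 1) * (x : ℂ) ^ b) x := by
  have h := ((hasDerivAt_id (x : ℂ)).cpow_const (c := b + 1)
    (Complex.ofReal_mem_slitPlane.2 hx)).comp_ofReal
  simpa using h

/-- Integration by parts on (0, ∞) after x ↦ σx. The boundary term at infinity vanishes because the
product and its derivative are integrable; at 0 it is the hypothesis `hz`, met either because Re b >
-1 or because ψ vanishes near 0. -/
theorem integral_halfPowFun_mul_deriv (σ : ℤˣ) (b : ℂ) (ψ : 𝓢(ℝ, ℂ))
    (h0 : Integrable (fun x => halfPowFun σ b x * ψ x))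
    (h1 : Integrable (fun x => halfPowFun σ (b + 1) x * ψ x))
    (h2 : Integrable (fun x => halfPowFun σ (b + 1) x * deriv ψ x))
    (hz : Tendsto (fun x : ℝ => (x : ℂ) ^ (b + 1) * ψ (sgn σ * x)) (𝓝[>] 0) (𝓝 0)) :
    ∫ x, halfPowFun σ (b + 1) x * deriv ψ x =
      -(sgn σ * (b + 1)) * ∫ x, halfPowFun σ b x * ψ x := by
  rw [integrable_halfPowFun_mul_iff] at h0 h1 h2
  rw [integral_halfPowFun_mul, integral_halfPowFun_mul]
  have hu : ∀ x ∈ Set.Ioi (0 : ℝ),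
      HasDerivAt (fun x : ℝ => (x : ℂ) ^ (b + 1)) ((b + 1) * (x : ℂ) ^ b) x :=
    fun x hx => hasDerivAt_cpow_add_one b hx
  have hv : ∀ x : ℝ, HasDerivAt (fun x : ℝ => ψ (sgn σ * x)) (sgn σ * deriv ψ (sgn σ * x)) x := by
    intro x
    have h2 : HasDerivAt (fun x : ℝ => sgn σ * x) (sgn σ) x := by
      simpa using (hasDerivAt_id x).const_mul (sgn σ)
    have h3 := (ψ.hasDerivAt (sgn σ * x)).scomp x h2
    rwa [Complex.real_smul] at h3
  have huv' : IntegrableOn ((fun x : ℝ => (x : ℂ) ^ (b + 1)) *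
      fun x => sgn σ * deriv ψ (sgn σ * x)) (Set.Ioi 0) := by
    refine (h2.const_mul (sgn σ : ℂ)).congr (Eventually.of_forall fun x => ?_)
    simp only [Pi.mul_apply]; ring
  have hu'v : IntegrableOn ((fun x : ℝ => (b + 1) * (x : ℂ) ^ b) *
      fun x => ψ (sgn σ * x)) (Set.Ioi 0) := by
    refine (h0.const_mul (b + 1)).congr (Eventually.of_forall fun x => ?_)
    simp only [Pi.mul_apply]; ring
  have hinf := tendsto_zero_of_hasDerivAt_of_integrableOn_Ioi
    (fun x hx => (hu x hx).mul (hv x)) (hu'v.add huv') h1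
  have key := integral_Ioi_mul_deriv_eq_deriv_mul hu (fun x _ => hv x) huv' hu'v hz hinf
  have e1 : ∫ x in Set.Ioi (0 : ℝ), (x : ℂ) ^ (b + 1) * (sgn σ * deriv ψ (sgn σ * x)) =
      sgn σ * ∫ x in Set.Ioi (0 : ℝ), (x : ℂ) ^ (b + 1) * deriv ψ (sgn σ * x) := by
    rw [← integral_const_mul]; congr 1; ext x; ring
  have e2 : ∫ x in Set.Ioi (0 : ℝ), (b + 1) * (x : ℂ) ^ b * ψ (sgn σ * x) =
      (b + 1) * ∫ x in Set.Ioi (0 : ℝ), (x : ℂ) ^ b * ψ (sgn σ * x) := by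
    rw [← integral_const_mul]; congr 1; ext x; ring
  rw [e1, e2] at key
  linear_combination (sgn σ : ℂ) * key -
    (∫ x in Set.Ioi (0 : ℝ), (x : ℂ) ^ (b + 1) * deriv ψ (sgn σ * x)) * sgn_mul_self_complex σ

theorem integral_halfPowFun_mul_deriv_of_re (σ : ℤˣ) (b : ℂ) (hb : -1 < b.re) (ψ : 𝓢(ℝ, ℂ)) :
    ∫ x, halfPowFun σ (b + 1) x * deriv ψ x =
      -(sgn σ * (b + 1)) * ∫ x, halfPowFun σ b x * ψ x := by
  have hb1 : 0 < (b + 1).re := by simp; linarith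
  have hm := moderate_halfPowFun σ (b + 1) (by linarith)
  refine integral_halfPowFun_mul_deriv σ b ψ ((moderate_halfPowFun σ b hb).integrable_pairing ψ)
    (hm.integrable_pairing ψ) ?_ ?_
  · simpa using hm.integrable_pairing (SchwartzMap.derivCLM ℂ ℂ ψ)
  · have h1 : ContinuousAt (fun x : ℝ => (x : ℂ) ^ (b + 1) * ψ (sgn σ * x)) 0 := by
      refine ContinuousAt.mul (Complex.continuousAt_ofReal_cpow_const 0 (b + 1) (Or.inl hb1)) ?_
      exact (ψ.continuous.comp (by fun_prop)).continuousAt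
    have h2 := h1.tendsto.mono_left (nhdsWithin_le_nhds (s := Set.Ioi 0))
    rwa [Complex.ofReal_zero, Complex.zero_cpow (fun h => by simp [h] at hb1), zero_mul] at h2

theorem eventuallyEq_zero_deriv {ψ : ℝ → ℂ} (hψ : ψ =ᶠ[𝓝 0] 0) : deriv ψ =ᶠ[𝓝 0] 0 := by
  refine hψ.deriv.trans (Eventually.of_forall fun x => ?_)
  exact congrFun (deriv_const' (0 : ℂ)) x

theorem integral_halfPowFun_mul_deriv_of_eventuallyEq_zero (σ : ℤˣ) (b : ℂ) (ψ : 𝓢(ℝ, ℂ))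
    (hψ : ψ =ᶠ[𝓝 0] 0) :
    ∫ x, halfPowFun σ (b + 1) x * deriv ψ x =
      -(sgn σ * (b + 1)) * ∫ x, halfPowFun σ b x * ψ x := by
  refine integral_halfPowFun_mul_deriv σ b ψ
    (integrable_halfPowFun_mul_of_eventuallyEq_zero σ b ψ hψ)
    (integrable_halfPowFun_mul_of_eventuallyEq_zero σ _ ψ hψ) ?_ ?_
  · have := integrable_halfPowFun_mul_of_eventuallyEq_zero σ (b + 1)
      (SchwartzMap.derivCLM ℂ ℂ ψ) ?_
    · simpa using this
    · have h : ((SchwartzMap.derivCLM ℂ ℂ ψ : 𝓢(ℝ, ℂ)) : ℝ → ℂ) = deriv ψ := by ext; simp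
      rw [h]
      exact eventuallyEq_zero_deriv hψ
  · have h1 : Tendsto (fun x : ℝ => sgn σ * x) (𝓝 0) (𝓝 0) := by
      have : Continuous (fun x : ℝ => sgn σ * x) := by fun_prop
      simpa using this.tendsto 0
    refine (tendsto_congr' ?_).2 tendsto_const_nhds
    filter_upwards [nhdsWithin_le_nhds (h1.eventually hψ)] with x hx
    rw [hx]; simp

/-! ### The entire family `χ_σ^b` -/

/-- A property of complex numbers that holds for `-1 < Re b` and passes from `b + 1` to `b` holds
everywhere. -/
theorem re_descent {P : ℂ → Prop} (base : ∀ b : ℂ, -1 < b.re → P b)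
    (step : ∀ b : ℂ, P (b + 1) → P b) (b : ℂ) : P b := by
  have h : ∀ (k : ℕ) (b : ℂ), -1 < b.re + k → P b := by
    intro k
    induction k with
    | zero => intro b hb; exact base b (by simpa using hb)
    | succ k ih =>
      intro b hb
      refine step b (ih _ ?_)
      push_cast at hb
      simp only [Complex.add_re, Complex.one_re]
      linarith
  have := lt_re_add_shift b
  exact h (shift b) b (by simpa using this)

theorem normHalfPow_of_re (σ : ℤˣ) (b : ℂ) (hb : -1 < b.re) :
    normHalfPow σ b = (Complex.Gamma (b + 1))⁻¹ • ofFun (halfPowFun σ b) := by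
  simp [normHalfPow, shift_eq_zero b hb]

theorem D_ofFun_halfPowFun (σ : ℤˣ) (b : ℂ) (hb : -1 < b.re) :
    D (ofFun (halfPowFun σ (b + 1))) = (sgn σ * (b + 1)) • ofFun (halfPowFun σ b) := by
  have hb1 : -1 < (b + 1).re := by simp; linarith
  ext φ
  rw [D_apply, smul_apply, ofFun_apply (moderate_halfPowFun σ b hb),
    ofFun_apply (moderate_halfPowFun σ _ hb1)]
  simp only [SchwartzMap.derivCLM_apply]
  rw [integral_halfPowFun_mul_deriv_of_re σ b hb φ, smul_eq_mul]
  ring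

/-- Hence χ^b and χ^{b+1} are built from iterated derivatives of one and the same function when Re b
≤ -1. -/
theorem shift_of_re_le (b : ℂ) (hb : b.re ≤ -1) : shift b = shift (b + 1) + 1 := by
  rw [shift, shift, Complex.add_re, Complex.one_re, ← Nat.floor_add_one (by linarith)]
  congr 1
  ring

/-- For Re b > -1 this is integration by parts together with (b+1)/Γ(b+2) = 1/Γ(b+1). For Re b ≤ -1
it is immediate from the definition, up to σ² = 1. -/
theorem D_normHalfPow (σ : ℤˣ) (b : ℂ) :
    D (normHalfPow σ (b + 1)) = (sgn σ : ℂ) • normHalfPow σ b := by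
  rcases lt_or_ge (-1) b.re with hb | hb
  · have hb1 : -1 < (b + 1).re := by simp; linarith
    rw [normHalfPow_of_re σ b hb, normHalfPow_of_re σ _ hb1, D_smul, D_ofFun_halfPowFun σ b hb,
      smul_smul, smul_smul, Complex.one_div_Gamma_eq_self_mul_one_div_Gamma_add_one (b + 1)]
    congr 1
    ring
  · have e : b + 1 + shift (b + 1) = b + (shift b : ℕ) := by
      rw [shift_of_re_le b hb]; push_cast; ring
    rw [normHalfPow, normHalfPow, e, D_smul, ← Function.iterate_succ_apply' D, smul_smul,
      Nat.succ_eq_add_one, ← shift_of_re_le b hb]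
    congr 1
    rw [shift_of_re_le b hb, pow_succ]
    linear_combination (-(sgn σ : ℂ) ^ shift (b + 1) /
      Complex.Gamma (b + ((shift (b + 1) + 1 : ℕ) : ℂ) + 1)) * sgn_mul_self_complex σ

theorem normHalfPow_eq_D (σ : ℤˣ) (b : ℂ) :
    normHalfPow σ b = (sgn σ : ℂ) • D (normHalfPow σ (b + 1)) := by
  rw [D_normHalfPow, smul_smul, sgn_mul_self_complex, one_smul]

theorem mul_halfPowFun (σ : ℤˣ) (b : ℂ) (x : ℝ) :
    x * halfPowFun σ b x = sgn σ * halfPowFun σ (b + 1) x := by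
  rw [halfPowFun, halfPowFun]
  split_ifs with h
  · have hx : |x| = sgn σ * x := by
      rw [← abs_of_pos h, abs_mul, abs_sgn, one_mul]
    have hx0 : ((|x| : ℝ) : ℂ) ≠ 0 := by
      rw [hx]; exact_mod_cast h.ne'
    rw [Complex.cpow_add _ _ hx0, Complex.cpow_one]
    have : (x : ℂ) = sgn σ * (|x| : ℝ) := by
      rw [hx, Complex.ofReal_mul, ← mul_assoc, sgn_mul_self_complex, one_mul]
    linear_combination ((|x| : ℝ) : ℂ) ^ b * this
  · simp

theorem mulX_normHalfPow (σ : ℤˣ) (b : ℂ) :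
    mulX (normHalfPow σ b) = (sgn σ * (b + 1)) • normHalfPow σ (b + 1) := by
  induction b using re_descent with
  | base b hb =>
    have hb1 : -1 < (b + 1).re := by simp; linarith
    rw [normHalfPow_of_re σ b hb, normHalfPow_of_re σ _ hb1, mulX_smul,
      Complex.one_div_Gamma_eq_self_mul_one_div_Gamma_add_one (b + 1)]
    ext φ
    rw [smul_apply, smul_apply, smul_apply, mulX_apply, ofFun_apply (moderate_halfPowFun σ b hb),
      ofFun_apply (moderate_halfPowFun σ _ hb1)]
    have : ∫ x, halfPowFun σ b x * mulXS φ x = sgn σ * ∫ x, halfPowFun σ (b + 1) x * φ x := by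
      rw [← integral_const_mul]
      congr 1
      ext x
      rw [mulXS_apply]
      linear_combination φ x * mul_halfPowFun σ b x
    rw [this]
    simp only [smul_eq_mul]
    ring
  | step b ih =>
    -- By x∂ = ∂x - 1, the coefficient b+2 from the induction hypothesis drops to b+1.
    rw [normHalfPow_eq_D, mulX_smul, mulX_D, ih, D_smul, D_normHalfPow σ (b + 1), smul_smul]
    ext φ
    simp only [smul_apply, sub_apply, smul_eq_mul]
    linear_combination ((sgn σ : ℂ) * (b + 1 + 1) * normHalfPow σ (b + 1) φ) *
      sgn_mul_self_complex σ

/-- Reflection anticommutes with ∂, and this sign is exactly the change from σ to -σ in the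
recursion. -/
theorem normHalfPow_neg_apply (σ : ℤˣ) (b : ℂ) (φ : 𝓢(ℝ, ℂ)) :
    normHalfPow (-σ) b φ = normHalfPow σ b (dilate (-1) (by norm_num) φ) := by
  induction b using re_descent generalizing φ with
  | base b hb =>
    rw [normHalfPow_of_re σ b hb, normHalfPow_of_re _ b hb, smul_apply, smul_apply,
      ofFun_apply (moderate_halfPowFun _ b hb), ofFun_apply (moderate_halfPowFun _ b hb),
      integral_halfPowFun_mul, integral_halfPowFun_mul]
    simp only [dilate_apply, sgn_neg]
    simp
  | step b ih =>
    rw [normHalfPow_eq_D, normHalfPow_eq_D σ, smul_apply, smul_apply, D_apply, D_apply, ih,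
      derivCLM_dilate_neg_one, sgn_neg, map_neg]
    simp

/-- The functional equation gives Γ(a+k+1) = (a+1)⋯(a+k)Γ(a+1), with all factors nonzero for the
admitted a. -/
theorem halfPow_eq_smul (σ : ℤˣ) (a : ℂ) (ha : ∀ n : ℕ, a ≠ -((n : ℂ) + 1)) :
    halfPow σ a = Complex.Gamma (a + 1) • normHalfPow σ a := by
  have hne : ∀ j : ℕ, a + (j + 1) ≠ 0 := fun j h => ha j (by linear_combination h)
  have hG : ∀ k : ℕ, Complex.Gamma (a + k + 1) =
      (∏ j ∈ Finset.range k, (a + (j + 1))) * Complex.Gamma (a + 1) := by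
    intro k
    induction k with
    | zero => simp
    | succ k ih =>
      rw [Finset.prod_range_succ, show a + ((k + 1 : ℕ) : ℂ) + 1 = (a + (k + 1)) + 1 by
        push_cast; ring, Complex.Gamma_add_one _ (hne k), ← add_assoc, ih]
      ring
  have hG0 : Complex.Gamma (a + 1) ≠ 0 := by
    refine Complex.Gamma_ne_zero fun m h => ha m ?_
    linear_combination h
  rw [halfPow, normHalfPow, smul_smul, hG]
  congr 1
  field_simp

/-- Off the origin χ_σ^b is a function for every b, since integration by parts has no boundary term
there. At negative integers b the value `(Complex.Gamma (b + 1))⁻¹ = 0` is the correct one: χ_σ^b is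
then supported at 0. -/
theorem normHalfPow_apply_of_eventuallyEq_zero (σ : ℤˣ) (b : ℂ) (ψ : 𝓢(ℝ, ℂ))
    (hψ : ψ =ᶠ[𝓝 0] 0) :
    normHalfPow σ b ψ = (Complex.Gamma (b + 1))⁻¹ * ∫ x, halfPowFun σ b x * ψ x := by
  induction b using re_descent generalizing ψ with
  | base b hb =>
    rw [normHalfPow_of_re σ b hb, smul_apply, ofFun_apply (moderate_halfPowFun _ b hb),
      smul_eq_mul]
  | step b ih =>
    have h : ((SchwartzMap.derivCLM ℂ ℂ ψ : 𝓢(ℝ, ℂ)) : ℝ → ℂ) = deriv ψ := by ext; simp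
    rw [normHalfPow_eq_D, smul_apply, D_apply, ih _ (h ▸ eventuallyEq_zero_deriv hψ), h,
      integral_halfPowFun_mul_deriv_of_eventuallyEq_zero σ b ψ hψ,
      Complex.one_div_Gamma_eq_self_mul_one_div_Gamma_add_one (b + 1), smul_eq_mul]
    linear_combination ((b + 1) * (Complex.Gamma (b + 1 + 1))⁻¹ *
      ∫ x, halfPowFun σ b x * ψ x) * sgn_mul_self_complex σ

/-! ### Fourier transform of integrable functions -/

/-- The Fourier integral with kernel `(2π)^(-1/2) e^{-ixξ}`. -/
def fourierFun (k : ℝ → ℂ) (ξ : ℝ) : ℂ :=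
  ((1 / Real.sqrt (2 * Real.pi) : ℝ) : ℂ) * ∫ x : ℝ, Complex.exp (-(Complex.I * x * ξ)) * k x

theorem fourierFun_eq (k : ℝ → ℂ) (ξ : ℝ) :
    fourierFun k ξ = ((1 / Real.sqrt (2 * Real.pi) : ℝ) : ℂ) * 𝓕 k ((2 * Real.pi)⁻¹ * ξ) := by
  rw [fourierFun, Real.fourier_real_eq_integral_exp_smul]
  congr 2
  ext x
  rw [smul_eq_mul]
  congr 2
  have : (Real.pi : ℂ) ≠ 0 := by exact_mod_cast Real.pi_ne_zero
  push_cast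
  field_simp

theorem norm_exp_neg_I_mul_mul (x ξ : ℝ) : ‖Complex.exp (-(Complex.I * x * ξ))‖ = 1 := by
  rw [Complex.norm_exp]; simp

theorem norm_fourierFun_le (k : ℝ → ℂ) (ξ : ℝ) :
    ‖fourierFun k ξ‖ ≤ 1 / Real.sqrt (2 * Real.pi) * ∫ x, ‖k x‖ := by
  rw [fourierFun, norm_mul, Complex.norm_real, Real.norm_of_nonneg (by positivity)]
  gcongr
  refine (norm_integral_le_integral_norm _).trans (le_of_eq ?_)
  simp [norm_exp_neg_I_mul_mul]

theorem integral_mul_fourierS {k : ℝ → ℂ} (hk : Integrable k) (φ : 𝓢(ℝ, ℂ)) :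
    ∫ x, k x * fourierS φ x = ∫ ξ, fourierFun k ξ * φ ξ := by
  set c : ℂ := ((1 / Real.sqrt (2 * Real.pi) : ℝ) : ℂ) with hc
  have hint : Integrable (fun p : ℝ × ℝ =>
      Complex.exp (-(Complex.I * p.1 * p.2)) * (k p.1 * φ p.2)) (volume.prod volume) := by
    refine (hk.mul_prod φ.integrable).bdd_mul (c := 1) ?_ ?_
    · exact (Continuous.aestronglyMeasurable (by fun_prop))
    · exact Eventually.of_forall fun p => (norm_exp_neg_I_mul_mul p.1 p.2).le
  have e1 : ∀ x, k x * fourierS φ x =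
      c * ∫ ξ : ℝ, Complex.exp (-(Complex.I * x * ξ)) * (k x * φ ξ) := by
    intro x
    have : ∫ ξ : ℝ, Complex.exp (-(Complex.I * x * ξ)) * (k x * φ ξ) =
        k x * ∫ ξ : ℝ, Complex.exp (-(Complex.I * ξ * x)) * φ ξ := by
      rw [← integral_const_mul]
      congr 1; ext ξ
      rw [mul_right_comm Complex.I]; ring
    rw [fourierS_apply, ← hc, this]; ring
  have e2 : ∀ ξ, fourierFun k ξ * φ ξ =
      c * ∫ x : ℝ, Complex.exp (-(Complex.I * x * ξ)) * (k x * φ ξ) := by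
    intro ξ
    rw [fourierFun, ← hc, mul_assoc, ← integral_mul_const]
    congr 2; ext x; ring
  simp_rw [e1, e2]
  rw [integral_const_mul, integral_const_mul]
  congr 1
  exact integral_integral_swap (f := fun x ξ : ℝ =>
    Complex.exp (-(Complex.I * x * ξ)) * (k x * φ ξ)) hint

theorem Moderate.of_integrable {k : ℝ → ℂ} (hk : Integrable k) : Moderate k :=
  ⟨0, by simpa using hk⟩

theorem contDiff_fourierFun {k : ℝ → ℂ} {N : ℕ∞}
    (hk : ∀ n : ℕ, n ≤ N → Integrable (fun x => ‖x‖ ^ n * ‖k x‖)) : ContDiff ℝ N (fourierFun k) := by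
  have h := Real.contDiff_fourier hk
  have h2 : fourierFun k = fun ξ =>
      ((1 / Real.sqrt (2 * Real.pi) : ℝ) : ℂ) * 𝓕 k ((2 * Real.pi)⁻¹ * ξ) :=
    funext (fourierFun_eq k)
  rw [h2]
  exact contDiff_const.mul (h.comp (contDiff_const.mul contDiff_id))

theorem continuous_fourierFun {k : ℝ → ℂ} (hk : Integrable k) : Continuous (fourierFun k) := by
  refine (contDiff_fourierFun (N := 0) fun n hn => ?_).continuous
  have : n = 0 := by simpa using hn
  simpa [this] using hk.norm

theorem Moderate.of_bounded {g : ℝ → ℂ} (hg : AEStronglyMeasurable g) {C : ℝ}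
    (h : ∀ x, ‖g x‖ ≤ C) : Moderate g := by
  have h1 : Moderate (fun _ => (1 : ℂ)) := by
    refine ⟨2, ?_⟩
    have hint : Integrable (fun x : ℝ => (1 + ‖x‖) ^ (-(2 : ℝ))) :=
      integrable_one_add_norm (by simp)
    refine (hint.ofReal (𝕜 := ℂ)).congr (Eventually.of_forall fun x => ?_)
    have e : (1 + ‖x‖) ^ (-(2 : ℝ)) = ((1 + |x|) ^ 2)⁻¹ := by
      rw [Real.rpow_neg (by positivity), Real.norm_eq_abs]; norm_cast
    simp only [e]
    simp
  exact h1.mono hg C fun x => by simpa using h x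

theorem moderate_fourierFun {k : ℝ → ℂ} (hk : Integrable k) : Moderate (fourierFun k) :=
  Moderate.of_bounded (continuous_fourierFun hk).aestronglyMeasurable (norm_fourierFun_le k)

theorem fourierT_ofFun {k : ℝ → ℂ} (hk : Integrable k) :
    fourierT (ofFun k) = ofFun (fourierFun k) := by
  ext φ
  rw [fourierT_apply, ofFun_apply (Moderate.of_integrable hk),
    ofFun_apply (moderate_fourierFun hk), integral_mul_fourierS hk]

/-! ### The Laplace transform of a power -/

theorem norm_cpow_mul_cexp (b r : ℂ) {x : ℝ} (hx : 0 < x) :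
    ‖(x : ℂ) ^ b * Complex.exp (-(r * x))‖ = x ^ b.re * Real.exp (-r.re * x) := by
  rw [norm_mul, Complex.norm_cpow_eq_rpow_re_of_pos hx, Complex.norm_exp]
  simp

theorem integrableOn_rpow_mul_exp {s r : ℝ} (hs : -1 < s) (hr : 0 < r) :
    IntegrableOn (fun x : ℝ => x ^ s * Real.exp (-r * x)) (Set.Ioi 0) := by
  simpa using integrableOn_rpow_mul_exp_neg_mul_rpow hs (zero_lt_one' ℝ) hr

theorem aestronglyMeasurable_cpow_mul_cexp (b r : ℂ) (s : Set ℝ) :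
    AEStronglyMeasurable (fun x : ℝ => (x : ℂ) ^ b * Complex.exp (-(r * x)))
      (volume.restrict s) := by
  have : Measurable (fun x : ℝ => (x : ℂ) ^ b * Complex.exp (-(r * x))) := by fun_prop
  exact this.aestronglyMeasurable

theorem integrableOn_cpow_mul_cexp {b r : ℂ} (hb : -1 < b.re) (hr : 0 < r.re) :
    IntegrableOn (fun x : ℝ => (x : ℂ) ^ b * Complex.exp (-(r * x))) (Set.Ioi 0) := by
  refine (integrableOn_rpow_mul_exp hb hr).mono' (aestronglyMeasurable_cpow_mul_cexp b r _) ?_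
  filter_upwards [ae_restrict_mem measurableSet_Ioi] with x hx
  exact (norm_cpow_mul_cexp b r hx).le

theorem differentiableAt_integral_cpow_mul_cexp {b r : ℂ} (hb : -1 < b.re) (hr : 0 < r.re) :
    DifferentiableAt ℂ
      (fun r : ℂ => ∫ x in Set.Ioi (0 : ℝ), (x : ℂ) ^ b * Complex.exp (-(r * x))) r := by
  have hb1 : -1 < b.re + 1 := by linarith
  have h := hasDerivAt_integral_of_dominated_loc_of_deriv_le
    (μ := volume.restrict (Set.Ioi (0 : ℝ)))
    (F := fun r (x : ℝ) => (x : ℂ) ^ b * Complex.exp (-(r * x)))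
    (F' := fun r (x : ℝ) => (x : ℂ) ^ b * (Complex.exp (-(r * x)) * -(x : ℂ)))
    -- On this ball Re s ≥ Re r / 2, so a single exponential dominates all the derivatives.
    (x₀ := r) (s := Metric.ball r (r.re / 2))
    (bound := fun x => x ^ (b.re + 1) * Real.exp (-(r.re / 2) * x))
    (Metric.ball_mem_nhds r (by linarith))
    (Eventually.of_forall fun r => aestronglyMeasurable_cpow_mul_cexp b r _)
    (integrableOn_cpow_mul_cexp hb hr) ?_ ?_ (integrableOn_rpow_mul_exp hb1 (by linarith)) ?_
  · exact h.2.differentiableAt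
  · have : Measurable (fun x : ℝ => (x : ℂ) ^ b * (Complex.exp (-(r * x)) * -(x : ℂ))) := by
      fun_prop
    exact this.aestronglyMeasurable
  · filter_upwards [ae_restrict_mem measurableSet_Ioi] with x hx s hs
    have hx0 : 0 < x := hx
    have hre : r.re / 2 ≤ s.re := by
      have h1 := (Complex.abs_re_le_norm (s - r)).trans_lt (mem_ball_iff_norm.1 hs)
      rw [Complex.sub_re, abs_lt] at h1
      linarith [h1.1]
    rw [← mul_assoc, norm_mul, norm_cpow_mul_cexp b s hx0, norm_neg, Complex.norm_real,
      Real.norm_of_nonneg hx0.le, Real.rpow_add_one hx0.ne']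
    calc _ = x ^ b.re * x * Real.exp (-s.re * x) := by ring
      _ ≤ _ := by gcongr
  · refine Eventually.of_forall fun x s _ => ?_
    have h1 : HasDerivAt (fun s : ℂ => -(s * (x : ℂ))) (-(x : ℂ)) s := by
      have h2 := ((hasDerivAt_id s).mul_const (x : ℂ)).neg
      rwa [one_mul] at h2
    exact h1.cexp.const_mul _

/-- Both sides are holomorphic in r on the right half-plane and agree on the positive reals by the
Gamma integral; the identity theorem, applied at 1, does the rest. -/
theorem integral_cpow_mul_cexp {b r : ℂ} (hb : -1 < b.re) (hr : 0 < r.re) :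
    ∫ x in Set.Ioi (0 : ℝ), (x : ℂ) ^ b * Complex.exp (-(r * x)) =
      r ^ (-b - 1) * Complex.Gamma (b + 1) := by
  have hopen : IsOpen {z : ℂ | 0 < z.re} := isOpen_lt continuous_const Complex.continuous_re
  have hf : AnalyticOnNhd ℂ
      (fun r : ℂ => ∫ x in Set.Ioi (0 : ℝ), (x : ℂ) ^ b * Complex.exp (-(r * x)))
      {z : ℂ | 0 < z.re} :=
    DifferentiableOn.analyticOnNhd
      (fun z hz => (differentiableAt_integral_cpow_mul_cexp hb hz).differentiableWithinAt) hopen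
  have hg : AnalyticOnNhd ℂ (fun r : ℂ => r ^ (-b - 1) * Complex.Gamma (b + 1))
      {z : ℂ | 0 < z.re} := by
    refine DifferentiableOn.analyticOnNhd (fun z hz => ?_) hopen
    refine DifferentiableAt.differentiableWithinAt ?_
    exact (differentiableAt_id.cpow_const (Or.inl hz)).mul_const _
  have hreal : ∀ t : ℝ, 0 < t →
      ∫ x in Set.Ioi (0 : ℝ), (x : ℂ) ^ b * Complex.exp (-((t : ℂ) * x)) =
        (t : ℂ) ^ (-b - 1) * Complex.Gamma (b + 1) := by
    intro t ht
    have h := Complex.integral_cpow_mul_exp_neg_mul_Ioi (a := b + 1) (r := t)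
      (by simp; linarith) ht
    rw [add_sub_cancel_right] at h
    rw [h, one_div, Complex.inv_cpow _ _
        (by rw [Complex.arg_ofReal_of_nonneg ht.le]; exact Real.pi_ne_zero.symm), ← Complex.cpow_neg, neg_add']
  have hconn : IsPreconnected {z : ℂ | 0 < z.re} := (convex_halfSpace_re_gt 0).isPreconnected
  have hfreq : ∃ᶠ z in 𝓝[≠] (1 : ℂ),
      ∫ x in Set.Ioi (0 : ℝ), (x : ℂ) ^ b * Complex.exp (-(z * x)) =
        z ^ (-b - 1) * Complex.Gamma (b + 1) := by
    have ht : Tendsto (fun t : ℝ => (t : ℂ)) (𝓝[>] 1) (𝓝[≠] 1) := by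
      refine tendsto_nhdsWithin_iff.2 ⟨?_, ?_⟩
      · have := (Complex.continuous_ofReal.tendsto 1).mono_left
          (nhdsWithin_le_nhds (s := Set.Ioi (1 : ℝ)))
        simpa using this
      · filter_upwards [self_mem_nhdsWithin] with t ht
        have : t ≠ 1 := ne_of_gt ht
        simpa using this
    refine ht.frequently (Eventually.frequently ?_)
    filter_upwards [self_mem_nhdsWithin] with t ht
    exact hreal t (one_pos.trans ht)
  exact hf.eqOn_of_preconnected_of_frequently_eq hg hconn (by simp) hfreq hr

/-! ### Fourier transform of `χ_σ^b` -/

theorem exp_sgn_mul_I_mul_pi_div_two (σ : ℤˣ) :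
    Complex.exp (sgn σ * Complex.I * Real.pi / 2) = sgn σ * Complex.I := by
  rcases Int.units_eq_one_or σ with rfl | rfl
  · have : (sgn 1 : ℂ) * Complex.I * Real.pi / 2 = Real.pi / 2 * Complex.I := by
      simp [sgn]; ring
    rw [this, Complex.exp_pi_div_two_mul_I]; simp [sgn]
  · have : (sgn (-1) : ℂ) * Complex.I * Real.pi / 2 = -Real.pi / 2 * Complex.I := by
      simp [sgn]; ring
    rw [this, Complex.exp_neg_pi_div_two_mul_I]; simp [sgn]

theorem lineFun_base_ne_zero (σ : ℤˣ) {η : ℝ} (hη : 0 < η) (ξ : ℝ) :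
    (ξ : ℂ) + sgn σ * η * Complex.I ≠ 0 := by
  intro h
  have := congrArg Complex.im h
  simp [sgn_ne_zero, hη.ne'] at this

/-- One has η + iσξ = σi(ξ - iση). The point ξ - iση lies in the half-plane on the side of -σ, so
turning it by σπ/2 does not cross the branch cut and the principal logarithms add. -/
theorem add_mul_I_cpow (σ : ℤˣ) {η : ℝ} (hη : 0 < η) (c : ℂ) (ξ : ℝ) :
    ((η : ℂ) + sgn σ * ξ * Complex.I) ^ c =
      Complex.exp (sgn σ * Complex.I * Real.pi * c / 2) * lineFun (-σ) η c ξ := by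
  set z : ℂ := (ξ : ℂ) + sgn (-σ) * η * Complex.I with hz
  have hz0 : z ≠ 0 := lineFun_base_ne_zero (-σ) hη ξ
  have hw : (η : ℂ) + sgn σ * ξ * Complex.I = sgn σ * Complex.I * z := by
    rw [hz, sgn_neg]
    push_cast
    linear_combination (-(η : ℂ)) * sgn_mul_self_complex σ +
      (η : ℂ) * ((sgn σ : ℂ) * sgn σ) * Complex.I_mul_I
  have hw0 : (η : ℂ) + sgn σ * ξ * Complex.I ≠ 0 := by
    intro h
    have := congrArg Complex.re h
    simp [hη.ne'] at this
  have hlog : Complex.log ((η : ℂ) + sgn σ * ξ * Complex.I) =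
      Complex.log z + sgn σ * Complex.I * Real.pi / 2 := by
    have hexp : Complex.exp (Complex.log z + sgn σ * Complex.I * Real.pi / 2) =
        (η : ℂ) + sgn σ * ξ * Complex.I := by
      rw [Complex.exp_add, Complex.exp_log hz0, exp_sgn_mul_I_mul_pi_div_two, hw]; ring
    have him : (Complex.log z + sgn σ * Complex.I * Real.pi / 2).im =
        z.arg + sgn σ * Real.pi / 2 := by
      rw [Complex.add_im, Complex.log_im]
      congr 1
      have : (sgn σ : ℂ) * Complex.I * Real.pi / 2 = ((sgn σ * Real.pi / 2 : ℝ) : ℂ) * Complex.I := by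
        push_cast; ring
      rw [this, Complex.im_ofReal_mul]; simp
    rw [← hexp, Complex.log_exp]
    · rw [him]
      rcases Int.units_eq_one_or σ with rfl | rfl
      · have := Complex.neg_pi_lt_arg z
        simp only [sgn, Units.val_one, Int.cast_one, one_mul]
        linarith [Real.pi_pos]
      · have : 0 ≤ z.arg := by
          rw [Complex.arg_nonneg_iff, hz]; simp [sgn, hη.le]
        simp only [sgn, Units.val_neg, Units.val_one, Int.cast_neg, Int.cast_one]
        linarith [Real.pi_pos]
    · rw [him]
      rcases Int.units_eq_one_or σ with rfl | rfl
      · have : z.arg < 0 := by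
          rw [Complex.arg_neg_iff, hz]; simp [sgn, hη]
        simp only [sgn, Units.val_one, Int.cast_one, one_mul]
        linarith [Real.pi_pos]
      · have := Complex.arg_le_pi z
        simp only [sgn, Units.val_neg, Units.val_one, Int.cast_neg, Int.cast_one]
        linarith [Real.pi_pos]
  rw [lineFun, ← hz, Complex.cpow_def_of_ne_zero hw0, Complex.cpow_def_of_ne_zero hz0,
    hlog, ← Complex.exp_add]
  congr 1
  ring

theorem lineFun_add_one (σ : ℤˣ) {η : ℝ} (hη : 0 < η) (c : ℂ) (ξ : ℝ) :
    lineFun σ η (c + 1) ξ = ((ξ : ℂ) + sgn σ * η * Complex.I) * lineFun σ η c ξ := by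
  rw [lineFun, lineFun, Complex.cpow_add _ _ (lineFun_base_ne_zero σ hη ξ), Complex.cpow_one,
    mul_comm]

/-- The function `x_σ^b` damped by `e^{-η|x|}`. -/
def dampedPowFun (σ : ℤˣ) (η : ℝ) (b : ℂ) (x : ℝ) : ℂ :=
  halfPowFun σ b x * Complex.exp (-(η * |x| : ℝ))

theorem cpow_mul_cexp_damped (σ : ℤˣ) (η : ℝ) (b : ℂ) (ξ : ℝ) {x : ℝ} (hx : 0 < x) :
    (x : ℂ) ^ b * (Complex.exp (-(η * |sgn σ * x| : ℝ)) *
      Complex.exp (-(Complex.I * ((sgn σ * x : ℝ) : ℂ) * ξ))) =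
      (x : ℂ) ^ b * Complex.exp (-(((η : ℂ) + sgn σ * ξ * Complex.I) * x)) := by
  rw [← Complex.exp_add, abs_mul, abs_sgn, one_mul, abs_of_pos hx]
  congr 2
  push_cast
  ring

theorem integrable_dampedPowFun (σ : ℤˣ) {η : ℝ} (hη : 0 < η) {b : ℂ} (hb : -1 < b.re) :
    Integrable (dampedPowFun σ η b) := by
  refine (integrable_halfPowFun_mul_iff σ b (fun x => Complex.exp (-(η * |x| : ℝ)))).2 ?_
  have h := integrableOn_cpow_mul_cexp (r := η) hb (by simpa using hη)
  refine h.congr_fun (fun x hx => ?_) measurableSet_Ioi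
  have := cpow_mul_cexp_damped σ η b 0 hx
  simpa using this.symm

theorem fourierFun_dampedPowFun (σ : ℤˣ) {η : ℝ} (hη : 0 < η) {b : ℂ} (hb : -1 < b.re) (ξ : ℝ) :
    fourierFun (dampedPowFun σ η b) ξ = ((1 / Real.sqrt (2 * Real.pi) : ℝ) : ℂ) *
      (Complex.Gamma (b + 1) * Complex.exp (-(sgn σ * Complex.I * Real.pi * (b + 1) / 2))) *
        lineFun (-σ) η (-b - 1) ξ := by
  have h1 : ∀ x : ℝ, Complex.exp (-(Complex.I * x * ξ)) * dampedPowFun σ η b x =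
      halfPowFun σ b x * (Complex.exp (-(η * |x| : ℝ)) * Complex.exp (-(Complex.I * x * ξ))) := by
    intro x; rw [dampedPowFun]; ring
  rw [fourierFun, integral_congr_ae (Eventually.of_forall h1), integral_halfPowFun_mul,
    setIntegral_congr_fun measurableSet_Ioi fun x hx => cpow_mul_cexp_damped σ η b ξ hx,
    integral_cpow_mul_cexp hb (by simpa using hη), add_mul_I_cpow σ hη]
  rw [show (sgn σ : ℂ) * Complex.I * Real.pi * (-b - 1) / 2 =
    -(sgn σ * Complex.I * Real.pi * (b + 1) / 2) by ring]
  ring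

theorem tendsto_integral_dampedPowFun (σ : ℤˣ) {b : ℂ} (hb : -1 < b.re) (φ : 𝓢(ℝ, ℂ)) :
    Tendsto (fun η : ℝ => ∫ x, dampedPowFun σ η b x * φ x) (𝓝[>] 0)
      (𝓝 (∫ x, halfPowFun σ b x * φ x)) := by
  refine tendsto_integral_filter_of_dominated_convergence
    (fun x => ‖halfPowFun σ b x * φ x‖) ?_ ?_ ?_ ?_
  · refine Eventually.of_forall fun η => ?_
    refine AEStronglyMeasurable.mul ?_ φ.continuous.aestronglyMeasurable
    refine (measurable_halfPowFun σ b).aestronglyMeasurable.mul ?_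
    exact Continuous.aestronglyMeasurable (by fun_prop)
  · filter_upwards [self_mem_nhdsWithin] with η hη
    refine Eventually.of_forall fun x => ?_
    have hη0 : 0 < η := hη
    rw [dampedPowFun, norm_mul, norm_mul, norm_mul, Complex.norm_exp]
    have : Real.exp (-((η * |x| : ℝ) : ℂ)).re ≤ 1 := by
      rw [Complex.neg_re, Complex.ofReal_re, Real.exp_le_one_iff]
      have : 0 ≤ η * |x| := by positivity
      linarith
    gcongr
    exact mul_le_of_le_one_right (norm_nonneg _) this
  · exact ((moderate_halfPowFun σ b hb).integrable_pairing φ).norm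
  · refine Eventually.of_forall fun x => ?_
    have hc : Continuous (fun η : ℝ => dampedPowFun σ η b x * φ x) := by
      unfold dampedPowFun; fun_prop
    have := (hc.tendsto 0).mono_left (nhdsWithin_le_nhds (s := Set.Ioi 0))
    simpa [dampedPowFun] using this

/-- The limit of `(ξ - σ i η)^(-b-1)` is a multiple of the Fourier transform of `χ_σ^b`. -/
theorem tendsto_lineFun (σ : ℤˣ) (b : ℂ) :
    Tendsto (fun η : ℝ => ofFun (lineFun (-σ) η (-b - 1))) (𝓝[>] 0)
      (𝓝 (((Real.sqrt (2 * Real.pi) : ℝ) *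
        Complex.exp (sgn σ * Complex.I * Real.pi * (b + 1) / 2)) •
          fourierT (normHalfPow σ b))) := by
  have hs : ((Real.sqrt (2 * Real.pi) : ℝ) : ℂ) ≠ 0 := by
    exact_mod_cast (Real.sqrt_pos.2 (by positivity : 0 < 2 * Real.pi)).ne'
  induction b using re_descent with
  | base b hb =>
    have hG : Complex.Gamma (b + 1) ≠ 0 :=
      Complex.Gamma_ne_zero_of_re_pos (by simp; linarith)
    refine PointwiseConvergenceCLM.tendsto_iff_forall_tendsto.2 fun φ => ?_
    -- The constant is the inverse of the factor in `fourierFun_dampedPowFun`.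
    have h := (tendsto_integral_dampedPowFun σ hb (fourierS φ)).const_mul
      ((Real.sqrt (2 * Real.pi) : ℝ) *
        Complex.exp (sgn σ * Complex.I * Real.pi * (b + 1) / 2) * (Complex.Gamma (b + 1))⁻¹)
    have e : ((Real.sqrt (2 * Real.pi) : ℝ) *
        Complex.exp (sgn σ * Complex.I * Real.pi * (b + 1) / 2) * (Complex.Gamma (b + 1))⁻¹) *
        (∫ x, halfPowFun σ b x * fourierS φ x) = (((Real.sqrt (2 * Real.pi) : ℝ) *
        Complex.exp (sgn σ * Complex.I * Real.pi * (b + 1) / 2)) •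
          fourierT (normHalfPow σ b)) φ := by
      rw [smul_apply, fourierT_apply, normHalfPow_of_re σ b hb, smul_apply,
        ofFun_apply (moderate_halfPowFun σ b hb)]
      simp only [smul_eq_mul]
      ring
    rw [e] at h
    refine h.congr' ?_
    filter_upwards [self_mem_nhdsWithin] with η hη
    rw [integral_mul_fourierS (integrable_dampedPowFun σ hη hb),
      ofFun_apply (moderate_lineFun (-σ) η hη _), ← integral_const_mul]
    congr 1
    ext ξ
    rw [fourierFun_dampedPowFun σ hη hb, Complex.exp_neg]
    have hE := Complex.exp_ne_zero (sgn σ * Complex.I * Real.pi * (b + 1) / 2)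
    push_cast
    field_simp
  | step b ih =>
    rw [PointwiseConvergenceCLM.tendsto_iff_forall_tendsto] at ih ⊢
    intro φ
    have hη : Tendsto (fun η : ℝ => (η : ℂ)) (𝓝[>] 0) (𝓝 0) := by
      have := (Complex.continuous_ofReal.tendsto 0).mono_left
        (nhdsWithin_le_nhds (s := Set.Ioi (0 : ℝ)))
      simpa using this
    -- Write (ξ - iση)^{-b-1} as (ξ - iση)(ξ - iση)^{-b-2}. The factor ξ moves to the test function;
    -- the term with η tends to 0 because the pairing it multiplies converges.
    have h := (ih (mulXS φ)).add ((hη.const_mul ((sgn (-σ) : ℂ) * Complex.I)).mul (ih φ))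
    rw [mul_zero, zero_mul, add_zero] at h
    have e : (((Real.sqrt (2 * Real.pi) : ℝ) *
        Complex.exp (sgn σ * Complex.I * Real.pi * (b + 1 + 1) / 2)) •
          fourierT (normHalfPow σ (b + 1))) (mulXS φ) = (((Real.sqrt (2 * Real.pi) : ℝ) *
        Complex.exp (sgn σ * Complex.I * Real.pi * (b + 1) / 2)) •
          fourierT (normHalfPow σ b)) φ := by
      rw [normHalfPow_eq_D σ b, map_smul, fourierT_D]
      simp only [smul_apply, mulX_apply, smul_eq_mul]
      -- The extra phase e^{iσπ/2} = σi is the factor that F produces from χ^b = σ∂χ^{b+1}.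
      rw [show (sgn σ : ℂ) * Complex.I * Real.pi * (b + 1 + 1) / 2 =
        sgn σ * Complex.I * Real.pi * (b + 1) / 2 + sgn σ * Complex.I * Real.pi / 2 by ring,
        Complex.exp_add, exp_sgn_mul_I_mul_pi_div_two]
      ring
    rw [e] at h
    refine h.congr' ?_
    filter_upwards [self_mem_nhdsWithin] with η hη
    have hm := moderate_lineFun (-σ) η hη (-(b + 1) - 1)
    rw [ofFun_apply hm, ofFun_apply hm, ofFun_apply (moderate_lineFun (-σ) η hη (-b - 1)),
      ← integral_const_mul, ← integral_add (hm.integrable_pairing _)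
        ((hm.integrable_pairing φ).const_mul _)]
    congr 1
    ext ξ
    rw [mulXS_apply, show -b - 1 = -(b + 1) - 1 + 1 by ring, lineFun_add_one (-σ) hη]
    ring

theorem boundaryPow_neg_eq (σ : ℤˣ) (b : ℂ) :
    boundaryPow (-σ) (-b - 1) = ((Real.sqrt (2 * Real.pi) : ℝ) *
        Complex.exp (sgn σ * Complex.I * Real.pi * (b + 1) / 2)) •
          fourierT (normHalfPow σ b) :=
  (tendsto_lineFun σ b).limUnder_eq

theorem tendsto_boundaryPow (σ : ℤˣ) (a : ℂ) :
    Tendsto (fun η : ℝ => ofFun (lineFun σ η a)) (𝓝[>] 0) (𝓝 (boundaryPow σ a)) := by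
  have h := tendsto_lineFun (-σ) (-a - 1)
  have e := boundaryPow_neg_eq (-σ) (-a - 1)
  rw [neg_neg, show -(-a - 1) - 1 = a by ring] at h e
  rwa [e]

theorem fourierT_normHalfPow (σ : ℤˣ) (b : ℂ) :
    fourierT (normHalfPow σ b) = ((1 : ℂ) / (Real.sqrt (2 * Real.pi) : ℝ) *
      Complex.exp (-(sgn σ * Complex.I * Real.pi * (b + 1) / 2))) •
        boundaryPow (-σ) (-b - 1) := by
  have hs : ((Real.sqrt (2 * Real.pi) : ℝ) : ℂ) ≠ 0 := by
    exact_mod_cast (Real.sqrt_pos.2 (by positivity : 0 < 2 * Real.pi)).ne'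
  have hE := Complex.exp_ne_zero (sgn σ * Complex.I * Real.pi * (b + 1) / 2)
  rw [boundaryPow_neg_eq, smul_smul, Complex.exp_neg]
  field_simp
  rw [one_smul]

/-- Since (x + σi0)^a is a multiple of F[χ_{-σ}^{-a-1}], a second transform reflects χ_{-σ} into
χ_σ. -/
theorem fourierT_boundaryPow (σ : ℤˣ) (a : ℂ) :
    fourierT (boundaryPow σ a) = ((Real.sqrt (2 * Real.pi) : ℝ) *
      Complex.exp (sgn σ * Complex.I * Real.pi * (a / 2))) • normHalfPow σ (-a - 1) := by
  have e := boundaryPow_neg_eq (-σ) (-a - 1)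
  rw [neg_neg, show -(-a - 1) - 1 = a by ring] at e
  rw [e, map_smul]
  have h : fourierT (fourierT (normHalfPow (-σ) (-a - 1))) = normHalfPow σ (-a - 1) := by
    ext φ
    rw [fourierT_fourierT_apply, ← normHalfPow_neg_apply, neg_neg]
  rw [h, sgn_neg]
  congr 3
  push_cast
  ring

/-! ### Homogeneity of the boundary values -/

theorem lineFun_mul_left (σ : ℤˣ) {t η : ℝ} (ht : 0 < t) (hη : 0 < η) (a : ℂ) (ξ : ℝ) :
    lineFun σ η a (t * ξ) = (t : ℂ) ^ a * lineFun σ (t⁻¹ * η) a ξ := by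
  have ht0 : (t : ℂ) ≠ 0 := by exact_mod_cast ht.ne'
  have hη' : 0 < t⁻¹ * η := mul_pos (inv_pos.2 ht) hη
  have hz := lineFun_base_ne_zero σ hη' ξ
  have e : ((t * ξ : ℝ) : ℂ) + sgn σ * η * Complex.I =
      t * (ξ + sgn σ * (t⁻¹ * η : ℝ) * Complex.I) := by
    push_cast
    field_simp
  rw [lineFun, lineFun, e, Complex.cpow_def_of_ne_zero (mul_ne_zero ht0 hz),
    Complex.log_ofReal_mul ht hz, Complex.cpow_def_of_ne_zero ht0,
    Complex.cpow_def_of_ne_zero hz, ← Complex.exp_add, ← Complex.ofReal_log ht.le, add_mul]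

/-- At height η scaling by t is exact except that η becomes η/t, which has the same limit 0+;
uniqueness of limits concludes. -/
theorem isPosHomogeneous_boundaryPow (σ : ℤˣ) (a : ℂ) : IsPosHomogeneous (boundaryPow σ a) a := by
  intro t ht φ
  have h := PointwiseConvergenceCLM.tendsto_iff_forall_tendsto.1 (tendsto_boundaryPow σ a)
  have hs : Tendsto (fun η : ℝ => t⁻¹ * η) (𝓝[>] 0) (𝓝[>] 0) := by
    refine tendsto_nhdsWithin_iff.2 ⟨?_, ?_⟩
    · have hc : Continuous (fun η : ℝ => t⁻¹ * η) := by fun_prop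
      have := (hc.tendsto 0).mono_left (nhdsWithin_le_nhds (s := Set.Ioi (0 : ℝ)))
      simpa using this
    · filter_upwards [self_mem_nhdsWithin] with η hη
      exact mul_pos (inv_pos.2 ht) hη
  refine tendsto_nhds_unique (h φ)
    ((((h ((t : ℂ) • dilate t ht.ne' φ)).comp hs).const_mul ((t : ℂ) ^ a)).congr' ?_)
  filter_upwards [self_mem_nhdsWithin] with η hη
  have hη' : 0 < t⁻¹ * η := mul_pos (inv_pos.2 ht) hη
  rw [Function.comp_apply, ofFun_apply (moderate_lineFun σ _ hη' a),
    ofFun_apply (moderate_lineFun σ η hη a), ← integral_const_mul]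
  obtain ⟨G, hG⟩ : ∃ G : ℝ → ℂ, G = fun ξ => lineFun σ η a ξ * φ ξ := ⟨_, rfl⟩
  have e : ∀ ξ : ℝ, (t : ℂ) ^ a * (lineFun σ (t⁻¹ * η) a ξ * ((t : ℂ) • dilate t ht.ne' φ) ξ) =
      t * G (t * ξ) := by
    intro ξ
    simp only [hG, smul_apply, dilate_apply, smul_eq_mul, lineFun_mul_left σ ht hη]
    ring
  have ht0 : (t : ℂ) ≠ 0 := by exact_mod_cast ht.ne'
  rw [integral_congr_ae (Eventually.of_forall e), integral_const_mul,
    Measure.integral_comp_mul_left, abs_of_pos (inv_pos.2 ht), Complex.real_smul, hG]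
  push_cast
  rw [mul_inv_cancel_left₀ ht0]

theorem IsPosHomogeneous.smul {T : 𝓢'(ℝ, ℂ)} {d : ℂ} (h : IsPosHomogeneous T d) (c : ℂ) :
    IsPosHomogeneous (c • T) d := by
  intro t ht φ
  rw [smul_apply, smul_apply, h t ht φ, smul_eq_mul, smul_eq_mul]
  ring

/-! ### Smoothness of Fourier transforms of compactly supported distributions -/

theorem Moderate.sub {f g : ℝ → ℂ} (hf : Moderate f) (hg : Moderate g) :
    Moderate (fun x => f x - g x) := by
  have key : ∀ {h : ℝ → ℂ} {N : ℕ} (M : ℕ),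
      Integrable (fun x : ℝ => ((1 + |x|) ^ N)⁻¹ • h x) →
        Integrable (fun x : ℝ => ((1 + |x|) ^ (N + M))⁻¹ • h x) := by
    intro h N M hN
    refine hN.mono ?_ (Eventually.of_forall fun x => ?_)
    · refine AEStronglyMeasurable.smul
        (Continuous.aestronglyMeasurable (f := fun x : ℝ => ((1 + |x|) ^ (N + M))⁻¹) ?_)
        (Moderate.aestronglyMeasurable ⟨N, hN⟩)
      refine Continuous.inv₀ (by fun_prop) fun x => ?_
      positivity
    · rw [norm_smul, norm_smul, norm_inv, norm_inv, Real.norm_of_nonneg (by positivity),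
        Real.norm_of_nonneg (by positivity)]
      have : 1 ≤ 1 + |x| := by linarith [abs_nonneg x]
      gcongr
      omega
  obtain ⟨N, hN⟩ := hf
  obtain ⟨M, hM⟩ := hg
  have h2 := key N hM
  rw [add_comm M N] at h2
  exact ⟨N + M, ((key M hN).sub h2).congr
    (Eventually.of_forall fun x => by simp only [Pi.sub_apply, smul_sub])⟩

theorem Moderate.id_mul {f : ℝ → ℂ} (hf : Moderate f) : Moderate (fun x => x * f x) := by
  have hm := hf.aestronglyMeasurable
  obtain ⟨N, hN⟩ := hf
  refine ⟨N + 1, hN.mono ?_ (Eventually.of_forall fun x => ?_)⟩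
  · refine AEStronglyMeasurable.smul
      (Continuous.aestronglyMeasurable (f := fun x : ℝ => ((1 + |x|) ^ (N + 1))⁻¹) ?_)
      (Complex.continuous_ofReal.aestronglyMeasurable.mul hm)
    refine Continuous.inv₀ (by fun_prop) fun x => ?_
    positivity
  · have hp : 0 < 1 + |x| := by positivity
    rw [norm_smul, norm_smul, norm_inv, norm_inv, norm_mul, Complex.norm_real, Real.norm_eq_abs x,
      Real.norm_of_nonneg (by positivity), Real.norm_of_nonneg (by positivity), pow_succ,
      mul_inv, mul_assoc]
    gcongr
    rw [← mul_assoc]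
    refine mul_le_of_le_one_left (norm_nonneg _) ?_
    rw [inv_mul_le_one₀ hp]
    linarith

theorem Moderate.const_mul {f : ℝ → ℂ} (hf : Moderate f) (c : ℂ) : Moderate (fun x => c * f x) :=
  hf.mono (hf.aestronglyMeasurable.const_mul c) ‖c‖ fun _ => (norm_mul _ _).le

theorem IsSmoothFun.sub {S T : 𝓢'(ℝ, ℂ)} (hS : IsSmoothFun S) (hT : IsSmoothFun T) :
    IsSmoothFun (S - T) := by
  obtain ⟨f, hf, hfm, rfl⟩ := hS
  obtain ⟨g, hg, hgm, rfl⟩ := hT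
  refine ⟨fun x => f x - g x, hf.sub hg, hfm.sub hgm, ?_⟩
  ext φ
  rw [sub_apply, ofFun_apply hfm, ofFun_apply hgm, ofFun_apply (hfm.sub hgm),
    ← integral_sub (hfm.integrable_pairing φ) (hgm.integrable_pairing φ)]
  congr 1; ext x; ring

theorem IsSmoothFun.mulX {T : 𝓢'(ℝ, ℂ)} (hT : IsSmoothFun T) : IsSmoothFun (mulX T) := by
  obtain ⟨g, hg, hgm, rfl⟩ := hT
  refine ⟨fun x => x * g x, Complex.ofRealCLM.contDiff.mul hg, hgm.id_mul, ?_⟩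
  ext φ
  rw [mulX_apply, ofFun_apply hgm, ofFun_apply hgm.id_mul]
  congr 1; ext x; rw [mulXS_apply]; ring

theorem IsSmoothFun.smul {T : 𝓢'(ℝ, ℂ)} (hT : IsSmoothFun T) (c : ℂ) : IsSmoothFun (c • T) := by
  obtain ⟨g, hg, hgm, rfl⟩ := hT
  refine ⟨fun x => c * g x, contDiff_const.mul hg, hgm.const_mul c, ?_⟩
  ext φ
  rw [smul_apply, ofFun_apply hgm, ofFun_apply (hgm.const_mul c), smul_eq_mul,
    ← integral_const_mul]
  congr 1; ext x; ring

/-- The Schwartz function `x ^ n * u x` for a smooth compactly supported real `u`. -/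
def powMulSchwartz (n : ℕ) (u : ℝ → ℝ) (hu : ContDiff ℝ ∞ u) (hc : HasCompactSupport u) :
    𝓢(ℝ, ℂ) :=
  HasCompactSupport.toSchwartzMap (f := fun x : ℝ => (x : ℂ) ^ n * (u x : ℂ))
    (HasCompactSupport.mul_left (hc.comp_left (g := Complex.ofReal) rfl))
    ((Complex.ofRealCLM.contDiff.pow n).mul (Complex.ofRealCLM.contDiff.comp hu))

theorem powMulSchwartz_apply (n : ℕ) (u : ℝ → ℝ) (hu : ContDiff ℝ ∞ u) (hc : HasCompactSupport u)
    (x : ℝ) : powMulSchwartz n u hu hc x = (x : ℂ) ^ n * (u x : ℂ) := rfl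

theorem isSmoothFun_fourierT_mulFun_ofFun {f : ℝ → ℂ} (hf : Moderate f) {u : ℝ → ℝ}
    (hu : ContDiff ℝ ∞ u) (hc : HasCompactSupport u) :
    IsSmoothFun (fourierT (mulFun u (ofFun f))) := by
  have hint : ∀ n : ℕ, Integrable (fun x => ‖x‖ ^ n * ‖(u x : ℂ) * f x‖) := by
    intro n
    refine (hf.integrable_pairing (powMulSchwartz n u hu hc)).norm.congr
      (Eventually.of_forall fun x => ?_)
    simp only [powMulSchwartz_apply, norm_mul, norm_pow, Complex.norm_real]
    ring
  have hint0 : Integrable (fun x => (u x : ℂ) * f x) := by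
    refine (hf.integrable_pairing (powMulSchwartz 0 u hu hc)).congr
      (Eventually.of_forall fun x => ?_)
    simp only [powMulSchwartz_apply]
    ring
  have e : mulFun u (ofFun f) = ofFun (fun x => (u x : ℂ) * f x) := by
    ext φ
    rw [mulFun_apply, ofFun_apply hf, ofFun_apply (Moderate.of_integrable hint0)]
    congr 1; ext x
    rw [smulLeft_apply (hc.hasTemperateGrowth hu)]
    ring
  rw [e, fourierT_ofFun hint0]
  exact ⟨_, contDiff_fourierFun (N := ⊤) fun n _ => hint n, moderate_fourierFun hint0, rfl⟩

theorem contDiff_deriv {u : ℝ → ℝ} (hu : ContDiff ℝ ∞ u) : ContDiff ℝ ∞ (deriv u) :=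
  (contDiff_infty_iff_deriv.1 hu).2

/-- Induction on k for all u at once, since u·∂T = ∂(uT) - u'T brings in u'; F turns ∂ into
multiplication by iξ, which preserves smoothness. -/
theorem isSmoothFun_fourierT_mulFun_iterate {f : ℝ → ℂ} (hf : Moderate f) (k : ℕ) {u : ℝ → ℝ}
    (hu : ContDiff ℝ ∞ u) (hc : HasCompactSupport u) :
    IsSmoothFun (fourierT (mulFun u (D^[k] (ofFun f)))) := by
  induction k generalizing u with
  | zero => exact isSmoothFun_fourierT_mulFun_ofFun hf hu hc
  | succ k ih =>
    have hu' := contDiff_deriv hu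
    have e := D_mulFun (hc.hasTemperateGrowth hu) (hc.deriv.hasTemperateGrowth hu')
      (D^[k] (ofFun f))
    rw [Function.iterate_succ_apply', ← sub_eq_of_eq_add' e, map_sub, fourierT_D]
    exact ((ih hu hc).mulX.smul _).sub (ih hu' hc.deriv)

theorem isSmoothFun_fourierT_mulFun_halfPow (σ : ℤˣ) (a : ℂ) {u : ℝ → ℝ}
    (hu : ContDiff ℝ ∞ u) (hc : HasCompactSupport u) :
    IsSmoothFun (fourierT (mulFun u (halfPow σ a))) := by
  rw [halfPow, mulFun_smul, map_smul]
  exact (isSmoothFun_fourierT_mulFun_iterate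
    (moderate_halfPowFun σ _ (lt_re_add_shift a)) _ hu hc).smul _

/-! ### Division of Schwartz functions vanishing near `0` by the coordinate -/

/-- The function (1-ρ)/x with a bump ρ. Its n-th derivative is bounded by compactness for |x| ≤ ε+1,
and beyond that by n!, being that of 1/x at a point with |x| ≥ 1. -/
theorem exists_hasTemperateGrowth_eq_inv {ε : ℝ} (hε : 0 < ε) :
    ∃ m : ℝ → ℝ, m.HasTemperateGrowth ∧ ∀ x, ε ≤ |x| → m x = x⁻¹ := by
  let ρ : ContDiffBump (0 : ℝ) := ⟨ε / 2, ε, by positivity, by linarith⟩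
  have heq : ∀ x, ε ≤ |x| → (1 - ρ x) * x⁻¹ = x⁻¹ := by
    intro x hx
    rw [ρ.zero_of_le_dist (by simpa using hx)]; ring
  have hsm : ContDiff ℝ ∞ (fun x : ℝ => (1 - ρ x) * x⁻¹) := by
    refine contDiff_iff_contDiffAt.2 fun x => ?_
    rcases eq_or_ne x 0 with rfl | hx
    · refine (contDiffAt_const (c := (0 : ℝ))).congr_of_eventuallyEq ?_
      filter_upwards [ρ.eventuallyEq_one] with x hx
      rw [hx]; simp
    · exact (contDiffAt_const.sub ρ.contDiff.contDiffAt).mul (contDiffAt_inv ℝ hx)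
  refine ⟨fun x => (1 - ρ x) * x⁻¹, ⟨hsm, fun n => ?_⟩, heq⟩
  have hcont : Continuous (fun x => ‖iteratedFDeriv ℝ n (fun x : ℝ => (1 - ρ x) * x⁻¹) x‖) :=
    (hsm.continuous_iteratedFDeriv (mod_cast le_top)).norm
  obtain ⟨C, hC⟩ := (isCompact_closedBall (0 : ℝ) (ε + 1)).bddAbove_image hcont.continuousOn
  refine ⟨0, max C n.factorial, fun x => ?_⟩
  rw [pow_zero, mul_one]
  rcases le_or_gt |x| (ε + 1) with hx | hx
  · exact le_max_of_le_left (hC ⟨x, by simpa using hx, rfl⟩)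
  · refine le_max_of_le_right ?_
    have hloc : (fun x : ℝ => (1 - ρ x) * x⁻¹) =ᶠ[𝓝 x] fun x => x⁻¹ := by
      have : ∀ᶠ y : ℝ in 𝓝 x, ε + 1 < |y| :=
        (continuous_abs.tendsto x).eventually (eventually_gt_nhds hx)
      filter_upwards [this] with y hy
      exact heq y (by linarith)
    have h1 : 1 ≤ |x| := by linarith
    rw [norm_iteratedFDeriv_eq_norm_iteratedDeriv, hloc.iteratedDeriv_eq,
      iteratedDeriv_eq_iterate, iter_deriv_inv]
    rw [norm_mul, norm_mul, norm_pow, norm_neg, norm_one, one_pow, one_mul, norm_zpow,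
      Real.norm_eq_abs, Real.norm_eq_abs, Nat.abs_cast]
    exact mul_le_of_le_one_right (by positivity) (zpow_le_one_of_nonpos₀ h1 (by omega))

theorem exists_mulXS_eq (φ : 𝓢(ℝ, ℂ)) (hφ : (0 : ℝ) ∉ tsupport φ) :
    ∃ ψ : 𝓢(ℝ, ℂ), (0 : ℝ) ∉ tsupport ψ ∧ mulXS ψ = φ := by
  obtain ⟨ε, hε, h⟩ := Metric.eventually_nhds_iff.1 (notMem_tsupport_iff_eventuallyEq.1 hφ)
  obtain ⟨m, hm, hmε⟩ := exists_hasTemperateGrowth_eq_inv hε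
  refine ⟨SchwartzMap.smulLeftCLM ℂ (fun x => (m x : ℂ)) φ, fun h0 => hφ ?_, ?_⟩
  · exact (SchwartzMap.tsupport_smulLeftCLM_subset _ _ h0).1
  · ext x
    rw [mulXS_apply, smulLeft_apply hm]
    rcases le_or_gt ε |x| with hx | hx
    · have hx0 : (x : ℂ) ≠ 0 := by
        have : x ≠ 0 := abs_pos.1 (hε.trans_le hx)
        exact_mod_cast this
      rw [hmε x hx, Complex.ofReal_inv, mul_inv_cancel_left₀ hx0]
    · rw [h (by simpa using hx)]; simp

/-! ### Distributions with finitely many derivatives and finite decay off `0` -/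

/-- On `ℝ \ {0}`, `T` is given by a function `g` of class `C^j` with `g = O(|ξ|^(-N))`. -/
def IsPowerDecreasing (j N : ℕ) (T : 𝓢'(ℝ, ℂ)) : Prop :=
  ∃ g : ℝ → ℂ, ContDiffOn ℝ j g {0}ᶜ ∧
    g =O[cocompact ℝ] (fun ξ : ℝ => (|ξ| ^ N)⁻¹) ∧
    ∀ φ : 𝓢(ℝ, ℂ), (0 : ℝ) ∉ tsupport φ → T φ = ∫ ξ, g ξ * φ ξ

theorem isBigO_one_of_isBigO_inv_pow {g : ℝ → ℂ} {N : ℕ}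
    (hg : g =O[cocompact ℝ] (fun ξ : ℝ => (|ξ| ^ N)⁻¹)) :
    g =O[cocompact ℝ] (fun _ => (1 : ℝ)) := by
  refine hg.trans (Asymptotics.IsBigO.of_bound 1 ?_)
  filter_upwards [tendsto_norm_cocompact_atTop.eventually_ge_atTop (1 : ℝ)] with ξ hξ
  rw [Real.norm_eq_abs] at hξ
  rw [norm_inv, norm_pow, Real.norm_eq_abs, abs_abs, norm_one, mul_one]
  exact inv_le_one_of_one_le₀ (one_le_pow₀ hξ)

theorem integrable_mul_of_notMem_tsupport {g : ℝ → ℂ} (hc : ContinuousOn g {0}ᶜ)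
    (hg : g =O[cocompact ℝ] (fun _ => (1 : ℝ))) (φ : 𝓢(ℝ, ℂ)) (hφ : (0 : ℝ) ∉ tsupport φ) :
    Integrable (fun ξ => g ξ * φ ξ) := by
  have hcont : Continuous (fun ξ => g ξ * φ ξ) := by
    refine continuous_iff_continuousAt.2 fun x => ?_
    rcases eq_or_ne x 0 with rfl | hx
    · refine (continuousAt_const (y := (0 : ℂ))).congr ?_
      filter_upwards [notMem_tsupport_iff_eventuallyEq.1 hφ] with x hx
      rw [hx]; simp
    · exact (hc.continuousAt (isOpen_compl_singleton.mem_nhds hx)).mul φ.continuous.continuousAt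
  refine hcont.locallyIntegrable.integrable_of_isBigO_cocompact (g := fun ξ => ‖φ ξ‖) ?_
    (φ.integrable.norm.integrableAtFilter _)
  simpa using hg.mul (Asymptotics.isBigO_refl φ (cocompact ℝ)).norm_right

theorem IsPowerDecreasing.add {j N : ℕ} {S T : 𝓢'(ℝ, ℂ)} (hS : IsPowerDecreasing j N S)
    (hT : IsPowerDecreasing j N T) : IsPowerDecreasing j N (S + T) := by
  obtain ⟨f, hf, hfO, hfT⟩ := hS
  obtain ⟨g, hg, hgO, hgT⟩ := hT
  refine ⟨fun ξ => f ξ + g ξ, hf.add hg, hfO.add hgO, fun φ hφ => ?_⟩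
  rw [add_apply, hfT φ hφ, hgT φ hφ, ← integral_add
    (integrable_mul_of_notMem_tsupport hf.continuousOn (isBigO_one_of_isBigO_inv_pow hfO) φ hφ)
    (integrable_mul_of_notMem_tsupport hg.continuousOn (isBigO_one_of_isBigO_inv_pow hgO) φ hφ)]
  congr 1; ext ξ; ring

theorem IsPowerDecreasing.smul {j N : ℕ} {T : 𝓢'(ℝ, ℂ)} (hT : IsPowerDecreasing j N T) (c : ℂ) :
    IsPowerDecreasing j N (c • T) := by
  obtain ⟨g, hg, hgO, hgT⟩ := hT
  refine ⟨fun ξ => c * g ξ, contDiffOn_const.mul hg, hgO.const_mul_left c, fun φ hφ => ?_⟩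
  rw [smul_apply, hgT φ hφ, smul_eq_mul, ← integral_const_mul]
  congr 1; ext ξ; ring

/-- Test functions vanishing near 0 have the form ξψ with ψ of the same kind, so off 0 one may
divide by ξ and gain one power of decay. -/
theorem IsPowerDecreasing.of_mulX {j N : ℕ} {T : 𝓢'(ℝ, ℂ)} (hT : IsPowerDecreasing j N (mulX T)) :
    IsPowerDecreasing j (N + 1) T := by
  obtain ⟨g, hg, hgO, hgT⟩ := hT
  refine ⟨fun ξ => g ξ * (ξ : ℂ)⁻¹, hg.mul ?_, ?_, fun φ hφ => ?_⟩
  · exact Complex.ofRealCLM.contDiff.contDiffOn.inv fun x hx => by simpa using hx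
  · have h1 : (fun ξ : ℝ => (ξ : ℂ)⁻¹) =O[cocompact ℝ] (fun ξ : ℝ => |ξ|⁻¹) :=
      Asymptotics.IsBigO.of_bound 1 (Eventually.of_forall fun ξ => by simp)
    refine (hgO.mul h1).congr_right fun ξ => ?_
    rw [pow_succ, mul_inv]
  · obtain ⟨ψ, hψ, rfl⟩ := exists_mulXS_eq φ hφ
    rw [← mulX_apply, hgT ψ hψ]
    congr 1; ext ξ
    rw [mulXS_apply]
    rcases eq_or_ne ξ 0 with rfl | hξ
    · rw [image_eq_zero_of_notMem_tsupport hψ]; simp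
    · have : (ξ : ℂ) ≠ 0 := by exact_mod_cast hξ
      field_simp

theorem isPowerDecreasing_fourierT_ofFun {j : ℕ} {k : ℝ → ℂ} (hk : Integrable k)
    (hkj : ∀ n ≤ j, Integrable (fun x => ‖x‖ ^ n * ‖k x‖)) :
    IsPowerDecreasing j 0 (fourierT (ofFun k)) := by
  refine ⟨fourierFun k, (contDiff_fourierFun (N := j) fun n hn =>
    hkj n (by exact_mod_cast hn)).contDiffOn, ?_, fun φ _ => ?_⟩
  · refine Asymptotics.IsBigO.of_bound (1 / Real.sqrt (2 * Real.pi) * ∫ x, ‖k x‖)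
      (Eventually.of_forall fun ξ => ?_)
    simpa using norm_fourierFun_le k ξ
  · rw [fourierT_ofFun hk, ofFun_apply (moderate_fourierFun hk)]

/-- The fundamental lemma of the calculus of variations gives equality almost everywhere, and
continuity upgrades it; boundedness at infinity makes the pairings integrable. -/
theorem eqOn_compl_zero_of_integral_eq {f g : ℝ → ℂ} (hf : ContinuousOn f {0}ᶜ)
    (hg : ContinuousOn g {0}ᶜ) (hfO : f =O[cocompact ℝ] (fun _ => (1 : ℝ)))
    (hgO : g =O[cocompact ℝ] (fun _ => (1 : ℝ)))
    (h : ∀ φ : 𝓢(ℝ, ℂ), (0 : ℝ) ∉ tsupport φ → ∫ ξ, f ξ * φ ξ = ∫ ξ, g ξ * φ ξ) :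
    Set.EqOn f g {0}ᶜ := by
  have hopen : IsOpen ({0}ᶜ : Set ℝ) := isOpen_compl_singleton
  have hae := hopen.ae_eq_zero_of_integral_contDiff_smul_eq_zero (μ := volume)
    (f := fun ξ => f ξ - g ξ) ((hf.sub hg).locallyIntegrableOn hopen.measurableSet) ?_
  · refine Measure.eqOn_open_of_ae_eq (μ := volume) ?_ hopen hf hg
    refine (ae_restrict_iff' hopen.measurableSet).2 ?_
    filter_upwards [hae] with ξ hξ h0
    exact sub_eq_zero.1 (hξ h0)
  · intro u hu hc hsupp
    have h0 : (0 : ℝ) ∉ tsupport (powMulSchwartz 0 u hu hc) := by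
      have h1 : (0 : ℝ) ∉ tsupport u := fun h => hsupp h rfl
      rw [notMem_tsupport_iff_eventuallyEq] at h1 ⊢
      filter_upwards [h1] with x hx
      rw [powMulSchwartz_apply, hx]; simp
    have e : ∀ ξ, u ξ • (f ξ - g ξ) = f ξ * powMulSchwartz 0 u hu hc ξ -
        g ξ * powMulSchwartz 0 u hu hc ξ := by
      intro ξ
      rw [powMulSchwartz_apply, Complex.real_smul]; ring
    rw [integral_congr_ae (Eventually.of_forall e), integral_sub
      (integrable_mul_of_notMem_tsupport hf hfO _ h0)
      (integrable_mul_of_notMem_tsupport hg hgO _ h0), h _ h0, sub_self]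

/-- The representatives for different N coincide off 0, so the one for N = 0 inherits the smoothness
and decay of all the others. -/
theorem isRapidlyDecreasing_of_isPowerDecreasing {T : 𝓢'(ℝ, ℂ)}
    (h : ∀ N : ℕ, IsPowerDecreasing N N T) : IsRapidlyDecreasing T := by
  choose g hg hgO hgT using h
  have heq : ∀ N, Set.EqOn (g 0) (g N) {0}ᶜ := fun N =>
    eqOn_compl_zero_of_integral_eq (hg 0).continuousOn (hg N).continuousOn
      (isBigO_one_of_isBigO_inv_pow (hgO 0)) (isBigO_one_of_isBigO_inv_pow (hgO N))
      fun φ hφ => (hgT 0 φ hφ).symm.trans (hgT N φ hφ)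
  refine ⟨g 0, contDiffOn_infty.2 fun N => (hg N).congr (heq N), fun N => ?_, hgT 0⟩
  refine (hgO N).congr' ?_ EventuallyEq.rfl
  filter_upwards [tendsto_norm_cocompact_atTop.eventually_ge_atTop (1 : ℝ)] with ξ hξ
  refine (heq N fun h0 => ?_).symm
  rw [Set.mem_singleton_iff.1 h0, norm_zero] at hξ
  linarith

/-! ### Fourier transforms of powers cut off near the origin -/

/-- Smooth bounded functions that vanish near `0` and are locally constant near infinity. -/
structure IsAwayFromZero (u : ℝ → ℝ) : Prop where
  smooth : ContDiff ℝ ∞ u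
  zero : u =ᶠ[𝓝 0] 0
  compact_deriv : HasCompactSupport (deriv u)
  bounded : ∃ C, ∀ x, |u x| ≤ C

theorem IsAwayFromZero.hasTemperateGrowth_deriv {u : ℝ → ℝ} (hu : IsAwayFromZero u) :
    (deriv u).HasTemperateGrowth :=
  hu.compact_deriv.hasTemperateGrowth (contDiff_deriv hu.smooth)

theorem IsAwayFromZero.hasTemperateGrowth {u : ℝ → ℝ} (hu : IsAwayFromZero u) :
    u.HasTemperateGrowth := by
  obtain ⟨C, hC⟩ := hu.bounded
  refine .of_fderiv ?_ (hu.smooth.differentiable (by simp)) (k := 0) (C := C) fun x => by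
    simpa using hC x
  refine HasCompactSupport.hasTemperateGrowth ?_ (hu.smooth.fderiv_right (by simp))
  refine hu.compact_deriv.mono fun x hx h => hx ?_
  ext
  simpa using h

theorem IsAwayFromZero.deriv {u : ℝ → ℝ} (hu : IsAwayFromZero u) : IsAwayFromZero (deriv u) where
  smooth := contDiff_deriv hu.smooth
  zero := hu.zero.deriv.trans (Eventually.of_forall fun x => congrFun (deriv_const' (0 : ℝ)) x)
  compact_deriv := hu.compact_deriv.deriv
  bounded := hu.compact_deriv.exists_bound_of_continuous (contDiff_deriv hu.smooth).continuous

theorem IsCutoff.isAwayFromZero_one_sub {w : ℝ → ℝ} (hw : IsCutoff w) :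
    IsAwayFromZero (fun x => 1 - w x) where
  smooth := contDiff_const.sub hw.smooth
  zero := by
    filter_upwards [hw.eq_one] with x hx
    simp [hx]
  compact_deriv := by
    have : _root_.deriv (fun x => 1 - w x) = -_root_.deriv w := by
      ext x; rw [deriv_const_sub]; rfl
    rw [this]
    exact hw.compact.deriv.neg
  bounded := by
    obtain ⟨C, hC⟩ := hw.compact.exists_bound_of_continuous hw.smooth.continuous
    refine ⟨1 + C, fun x => (abs_sub _ _).trans ?_⟩
    rw [abs_one]
    exact add_le_add_right (hC x) 1

theorem integrable_pow_mul_halfPowFun_of_hasCompactSupport (σ : ℤˣ) (b : ℂ) {u : ℝ → ℝ}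
    (hu : IsAwayFromZero u) (hc : HasCompactSupport u) (n : ℕ) :
    Integrable (fun x => halfPowFun σ b x * ((x : ℂ) ^ n * u x)) := by
  refine integrable_halfPowFun_mul_of_eventuallyEq_zero σ b (powMulSchwartz n u hu.smooth hc) ?_
  filter_upwards [hu.zero] with x hx
  rw [powMulSchwartz_apply, hx]; simp

theorem integrable_pow_mul_halfPowFun_of_re_lt (σ : ℤˣ) (b : ℂ) {u : ℝ → ℝ}
    (hu : IsAwayFromZero u) (n : ℕ) (hb : b.re + n < -1) :
    Integrable (fun x => halfPowFun σ b x * ((x : ℂ) ^ n * u x)) := by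
  obtain ⟨C, hC⟩ := hu.bounded
  obtain ⟨ε, hε, h⟩ := Metric.eventually_nhds_iff.1 hu.zero
  rw [integrable_halfPowFun_mul_iff]
  have hε2 : 0 < ε / 2 := by linarith
  have hbound : Integrable ((Set.Ioi (ε / 2)).indicator fun x : ℝ => C * x ^ (b.re + n)) :=
    (integrable_indicator_iff measurableSet_Ioi).2
      (((integrableOn_Ioi_rpow_iff hε2).2 hb).const_mul C)
  refine (hbound.integrableOn (s := Set.Ioi 0)).mono' ?_ ?_
  · have hm : Measurable u := hu.smooth.continuous.measurable
    have : Measurable (fun x : ℝ =>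
      (x : ℂ) ^ b * (((sgn σ * x : ℝ) : ℂ) ^ n * (u (sgn σ * x) : ℂ))) := by fun_prop
    exact this.aestronglyMeasurable
  · filter_upwards [ae_restrict_mem measurableSet_Ioi] with x hx
    have hx0 : 0 < x := hx
    have habs : |sgn σ * x| = x := by rw [abs_mul, abs_sgn, one_mul, abs_of_pos hx0]
    rcases le_or_gt x (ε / 2) with hxε | hxε
    · have : u (sgn σ * x) = 0 := h (by rw [Real.dist_eq, sub_zero, habs]; linarith)
      rw [this, Set.indicator_of_notMem (by simpa using hxε)]
      simp
    · rw [Set.indicator_of_mem (by exact hxε), norm_mul, norm_mul, norm_pow, Complex.norm_real,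
        Complex.norm_real, Real.norm_eq_abs, Real.norm_eq_abs, habs,
        Complex.norm_cpow_eq_rpow_re_of_pos hx0, Real.rpow_add_natCast hx0.ne', ← mul_assoc,
        mul_comm C]
      gcongr
      exact hC _

theorem mulFun_normHalfPow_eq_ofFun (σ : ℤˣ) (b : ℂ) {u : ℝ → ℝ} (hu : IsAwayFromZero u)
    (hint : Integrable (fun x => (Complex.Gamma (b + 1))⁻¹ * (halfPowFun σ b x * u x))) :
    mulFun u (normHalfPow σ b) =
      ofFun (fun x => (Complex.Gamma (b + 1))⁻¹ * (halfPowFun σ b x * u x)) := by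
  ext φ
  rw [mulFun_apply, ofFun_apply (Moderate.of_integrable hint),
    normHalfPow_apply_of_eventuallyEq_zero, ← integral_const_mul]
  · congr 1; ext x
    rw [smulLeft_apply hu.hasTemperateGrowth]
    ring
  · filter_upwards [hu.zero] with x hx
    rw [smulLeft_apply hu.hasTemperateGrowth, hx]; simp

/-- Each power of ξ costs one derivative: ∂(uχ^b) = u'χ^b + σuχ^{b-1}. The first term stays
compactly supported; in the second Re b drops by 1, so after N steps the bound reads Re b + j < -1,
which makes the moments up to order j integrable. -/
theorem isPowerDecreasing_fourierT_mulFun (σ : ℤˣ) (j N : ℕ) {u : ℝ → ℝ} (hu : IsAwayFromZero u)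
    (b : ℂ) (h : HasCompactSupport u ∨ b.re + j < N - 1) :
    IsPowerDecreasing j N (fourierT (mulFun u (normHalfPow σ b))) := by
  induction N generalizing u b with
  | zero =>
    have hmom : ∀ n ≤ j, Integrable (fun x => halfPowFun σ b x * ((x : ℂ) ^ n * u x)) := by
      intro n hn
      rcases h with hc | hb
      · exact integrable_pow_mul_halfPowFun_of_hasCompactSupport σ b hu hc n
      · refine integrable_pow_mul_halfPowFun_of_re_lt σ b hu n ?_
        have : (n : ℝ) ≤ j := by exact_mod_cast hn
        push_cast at hb
        linarith
    have hint : Integrable (fun x => (Complex.Gamma (b + 1))⁻¹ * (halfPowFun σ b x * u x)) := by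
      simpa using (hmom 0 (Nat.zero_le _)).const_mul (Complex.Gamma (b + 1))⁻¹
    rw [mulFun_normHalfPow_eq_ofFun σ b hu hint]
    refine isPowerDecreasing_fourierT_ofFun hint fun n hn => ?_
    refine ((hmom n hn).const_mul (Complex.Gamma (b + 1))⁻¹).norm.congr
      (Eventually.of_forall fun x => ?_)
    simp only [norm_mul, norm_pow, Complex.norm_real]
    ring
  | succ N ih =>
    refine IsPowerDecreasing.of_mulX ?_
    have e1 : mulX (fourierT (mulFun u (normHalfPow σ b))) =
        (-Complex.I) • fourierT (D (mulFun u (normHalfPow σ b))) := by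
      rw [fourierT_D, smul_smul]; simp
    have e2 := D_normHalfPow σ (b - 1)
    rw [sub_add_cancel] at e2
    rw [e1, D_mulFun hu.hasTemperateGrowth hu.hasTemperateGrowth_deriv, e2, mulFun_smul, map_add,
      map_smul]
    refine ((ih hu.deriv b (Or.inl hu.compact_deriv)).add ((ih hu (b - 1) ?_).smul _)).smul _
    refine h.imp_right fun hb => ?_
    push_cast at hb
    simp only [Complex.sub_re, Complex.one_re]
    linarith

theorem IsPowerDecreasing.mono {j M N : ℕ} (hMN : N ≤ M) {T : 𝓢'(ℝ, ℂ)}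
    (hT : IsPowerDecreasing j M T) : IsPowerDecreasing j N T := by
  obtain ⟨g, hg, hgO, hgT⟩ := hT
  refine ⟨g, hg, hgO.trans (Asymptotics.IsBigO.of_bound 1 ?_), hgT⟩
  filter_upwards [tendsto_norm_cocompact_atTop.eventually_ge_atTop (1 : ℝ)] with ξ hξ
  rw [Real.norm_eq_abs] at hξ
  rw [norm_inv, norm_inv, norm_pow, norm_pow, Real.norm_eq_abs, abs_abs, one_mul]
  gcongr

theorem isRapidlyDecreasing_smul_fourierT_mulFun (σ : ℤˣ) {u : ℝ → ℝ} (hu : IsAwayFromZero u)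
    (b c : ℂ) : IsRapidlyDecreasing (c • fourierT (mulFun u (normHalfPow σ b))) := by
  refine isRapidlyDecreasing_of_isPowerDecreasing fun N => ?_
  -- This M satisfies both M ≥ N and Re b + N < M - 1; the surplus decay is then discarded.
  refine (IsPowerDecreasing.mono (M := N + (⌊b.re + N + 1⌋₊ + 1)) (Nat.le_add_right _ _)
    (isPowerDecreasing_fourierT_mulFun σ N _ hu b (Or.inr ?_))).smul c
  have := Nat.lt_floor_add_one (b.re + N + 1)
  have h0 : (0 : ℝ) ≤ N := Nat.cast_nonneg N
  push_cast
  linarith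

/-! ### Back from χ_σ^a to x_σ^a -/

theorem mulX_halfPow (σ : ℤˣ) (a : ℂ) (ha : ∀ n : ℕ, a ≠ -((n : ℂ) + 1)) :
    mulX (halfPow σ a) = (sgn σ : ℂ) • halfPow σ (a + 1) := by
  have ha' : ∀ n : ℕ, a + 1 ≠ -((n : ℂ) + 1) := fun n h =>
    ha (n + 1) (by push_cast; linear_combination h)
  have h0 : a + 1 ≠ 0 := fun h => ha 0 (by push_cast; linear_combination h)
  rw [halfPow_eq_smul σ a ha, halfPow_eq_smul σ _ ha', mulX_smul, mulX_normHalfPow, smul_smul,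
    smul_smul, Complex.Gamma_add_one _ h0]
  congr 1
  ring

theorem fourierT_halfPow (σ : ℤˣ) (a : ℂ) (ha : ∀ n : ℕ, a ≠ -((n : ℂ) + 1)) :
    fourierT (halfPow σ a) = (Complex.Gamma (a + 1) / (Real.sqrt (2 * Real.pi) : ℝ) *
        Complex.exp (-(sgn σ * Complex.I * Real.pi * (a + 1) / 2))) •
          boundaryPow (-σ) (-a - 1) := by
  rw [halfPow_eq_smul σ a ha, map_smul, fourierT_normHalfPow, smul_smul]
  congr 1
  ring

end HomDist

end

open HomDist in
theorem mainTheorem4 (w : ℝ → ℝ) (hw : IsCutoff w) (a : ℂ) (ha : ∀ n : ℕ, a ≠ -((n : ℂ) + 1))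
    (σ : ℤˣ) :
    -- the boundary values `(ξ ∓ i0)^{-a-1}` and `(x ± i0)^a` exist
    Tendsto (fun η : ℝ => ofFun (lineFun (-σ) η (-a - 1))) (𝓝[>] 0)
      (𝓝 (boundaryPow (-σ) (-a - 1))) ∧
    Tendsto (fun η : ℝ => ofFun (lineFun σ η a)) (𝓝[>] 0) (𝓝 (boundaryPow σ a)) ∧
    -- `F[x_±^a]` is homogeneous, and its explicit value
    IsPosHomogeneous (fourierT (halfPow σ a)) (-a - 1) ∧
    fourierT (halfPow σ a) =
      (Complex.Gamma (a + 1) / (Real.sqrt (2 * Real.pi) : ℝ) *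
        Complex.exp (-(sgn σ * Complex.I * Real.pi * (a + 1) / 2))) •
          boundaryPow (-σ) (-a - 1) ∧
    -- `F[(x ± i0)^a]`
    fourierT (boundaryPow σ a) =
      ((Real.sqrt (2 * Real.pi) : ℝ) * Complex.exp (sgn σ * Complex.I * Real.pi * (a / 2))) •
        normHalfPow σ (-a - 1) ∧
    ((∀ n : ℕ, a ≠ n) →
      fourierT (boundaryPow σ a) =
        ((Real.sqrt (2 * Real.pi) : ℝ) / Complex.Gamma (-a) *
          Complex.exp (sgn σ * Complex.I * Real.pi * (a / 2))) • halfPow σ (-a - 1)) ∧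
    -- `F[w x_±^a]` is smooth, `F[(1 - w) x_±^a]` is rapidly decreasing
    IsSmoothFun (fourierT (mulFun w (halfPow σ a))) ∧
    IsRapidlyDecreasing (fourierT (mulFun (fun x => 1 - w x) (halfPow σ a))) ∧
    -- `F[w x_±^a]` modulo rapidly decreasing functions
    fourierT (halfPow σ a) = fourierT (mulFun w (halfPow σ a)) +
      fourierT (mulFun (fun x => 1 - w x) (halfPow σ a)) ∧
    IsRapidlyDecreasing (fourierT (mulFun w (halfPow σ a)) -
      (Complex.Gamma (a + 1) / (Real.sqrt (2 * Real.pi) : ℝ) *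
        Complex.exp (-(sgn σ * Complex.I * Real.pi * (a + 1) / 2))) •
          boundaryPow (-σ) (-a - 1)) ∧
    -- derivatives
    D (fourierT (halfPow σ a)) = (-Complex.I) • fourierT (mulFun (fun x => x) (halfPow σ a)) ∧
    D (fourierT (halfPow σ a)) = (-(sgn σ * Complex.I)) • fourierT (halfPow σ (a + 1)) := by
  have hF := fourierT_halfPow σ a ha
  have hB := fourierT_boundaryPow σ a
  have hD := D_fourierT (halfPow σ a)
  have hsplit : fourierT (halfPow σ a) = fourierT (mulFun w (halfPow σ a)) +
      fourierT (mulFun (fun x => 1 - w x) (halfPow σ a)) := by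
    rw [← map_add, mulFun_add_mulFun_one_sub (hw.compact.hasTemperateGrowth hw.smooth)]
  have haway : fourierT (mulFun (fun x => 1 - w x) (halfPow σ a)) =
      Complex.Gamma (a + 1) • fourierT (mulFun (fun x => 1 - w x) (normHalfPow σ a)) := by
    rw [halfPow_eq_smul σ a ha, mulFun_smul, map_smul]
  refine ⟨tendsto_boundaryPow _ _, tendsto_boundaryPow _ _, ?_, hF, hB, fun ha' => ?_,
    isSmoothFun_fourierT_mulFun_halfPow σ a hw.smooth hw.compact, ?_, hsplit, ?_, hD, ?_⟩
  · rw [hF]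
    exact (isPosHomogeneous_boundaryPow _ _).smul _
  · have hG : Complex.Gamma (-a) ≠ 0 :=
      Complex.Gamma_ne_zero fun m h => ha' m (neg_injective h)
    rw [hB, halfPow_eq_smul σ (-a - 1) fun n h => ha' n (by linear_combination -h), smul_smul,
      sub_add_cancel]
    congr 1
    field_simp
  · rw [haway]
    exact isRapidlyDecreasing_smul_fourierT_mulFun σ hw.isAwayFromZero_one_sub _ _
  -- The subtracted boundary value is F[x_σ^a] itself, so the remainder is -F[(1-ω)x_σ^a].
  · have e : fourierT (mulFun w (halfPow σ a)) - fourierT (halfPow σ a) =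
        (-Complex.Gamma (a + 1)) • fourierT (mulFun (fun x => 1 - w x) (normHalfPow σ a)) := by
      rw [hsplit, haway, sub_add_cancel_left]
      exact (neg_smul _ _).symm
    rw [← hF, e]
    exact isRapidlyDecreasing_smul_fourierT_mulFun σ hw.isAwayFromZero_one_sub _ _
  · rw [hD, mulX_halfPow σ a ha, map_smul, smul_smul]
    congr 1
    ring
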